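/- Let $\Omega\subset\mathbb R^N$ be a bounded open set (for instance a bounded smooth domain), let $m\ge 1$, and let $H^m_0(\Omega)$ be the closure of $C_c^\infty(\Omega)$ in the $H^m$-norm. By an eigenvalue $\mu$ of $(-\Delta)^m$ we mean a Dirichlet eigenvalue: the eigenspace $E_\mu=\{u\in H^m_0(\Omega): (-\Delta)^m u=\mu u \text{ weakly in }\Omega\}$ is non-zero; its dimension is the multiplicity of $\mu$. Fix an eigenvalue $\lambda_l$ and consider $$V'(\psi)=-(-\Delta)^m\psi+\lambda_l\psi-\Big(\int_\Omega\psi^2\Big)\psi ,\qquad \psi\in H^m_0(\Omega)$$ (for $m=1$: $\Delta\psi+\lambda_l\psi-(\int\psi^2)\psi$ with zero Dirichlet condition). Let $\Phi$ be the set of equilibria, i.e. of weak solutions $\psi\in H^m_0(\Omega)$ of $V'(\psi)=0$, and let $V''(\psi)$ be the Fréchet derivative of $V'$ at $\psi$ (tested against functions in $C_c^\infty(\Omega)$). Then: 1. Hypothesis $(\mathbf H_R)$ holds: if branching occurs at $\psi\in\Phi$ (that is, $\psi$ is not isolated in $\Phi$) and $\dim\ker V''(\psi)=k\ge1$, then $\Phi$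 is, in a neighbourhood of $\psi$ in $H^m_0(\Omega)$, a smooth $k$-dimensional embedded submanifold. Moreover $\ker V''(\psi)$ is finite-dimensional for every $\psi\in\Phi$. 2. For all $\psi,v\in H^m_0(\Omega)$, in the weak sense, $$V''(\psi)v=-(-\Delta)^m v+\lambda_l v-2\psi\int_\Omega\psi v-v\int_\Omega\psi^2 .$$ 3. Let $\lambda_j<\lambda_l$ be an eigenvalue of multiplicity $k+1\ge2$, let $\psi_{j,1},\dots,\psi_{j,k+1}\in E_{\lambda_j}$ be orthonormal in $L^2(\Omega)$, and put $$S_k=\Big\{\sum_{i=1}^{k+1}c_i\psi_{j,i}\;:\;\sum_{i=1}^{k+1} c_i^2=\lambda_l-\lambda_j\Big\}.$$ A combination $\sum_i c_i\psi_{j,i}$ is an equilibrium if and only if $c=0$ or $\sum_i c_i^2=\lambda_l-\lambda_j$, and the sphere $S_k$ is a smooth $k$-dimensional embedded submanifold of $H^m_0(\Omega)$. For every $\hat\psi=\sum_i\hat c_i\psi_{j,i}\in S_k$: branching occurs at $\hat\psi$; there is $\varepsilon>0$ such that a $\psi\in H^m_0(\Omega)$ with $\|\psi-\hat\psi\|_{L^2(\Omega)}<\varepsilon$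 is an equilibrium if and only if $\psi\in S_k$; $S_k$ is the connected component of $\hat\psi$ in $\Phi$; and $$\ker V''(\hat\psi)=\Big\{\sum_{i=1}^{k+1}b_i\psi_{j,i}\;:\;\sum_{i=1}^{k+1} b_i\hat c_i=0\Big\},$$ which has dimension exactly $k$. -/

import Mathlib

open MeasureTheory Topology TopologicalSpace Filter
open scoped ContDiff Distributions LineDeriv

noncomputable section

namespace NonlocalResonance

/-! ### Test functions and the polyharmonic operator -/

/-- The Euclidean space `ℝ^N`. -/
abbrev Space (N : ℕ) : Type := EuclideanSpace ℝ (Fin N)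

/-- The `i`-th coordinate vector of `ℝ^N`. -/
def coordVec {N : ℕ} (i : Fin N) : Space N := EuclideanSpace.single i 1

/-- The real Hilbert space `L²(Ω)`. -/
abbrev L2 {N : ℕ} (Ω : Opens (Space N)) : Type :=
  Lp ℝ 2 (volume.restrict (Ω : Set (Space N)))

theorem memLp_test {N : ℕ} (Ω : Opens (Space N)) (φ : 𝓓(Ω, ℝ)) :
    MemLp φ 2 (volume.restrict (Ω : Set (Space N))) :=
  φ.continuous.memLp_of_hasCompactSupport φ.hasCompactSupport

/-- The inclusion `C_c^∞(Ω) → L²(Ω)`. -/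
def testToL2 {N : ℕ} (Ω : Opens (Space N)) : 𝓓(Ω, ℝ) →ₗ[ℝ] L2 Ω where
  toFun φ := (memLp_test Ω φ).toLp φ
  map_add' _ _ := rfl
  map_smul' _ _ := rfl

/-- The Laplacian `∑ᵢ ∂ᵢ∂ᵢ` as a linear map `C_c^∞(Ω) → C_c^∞(Ω)`. -/
def testLaplacian {N : ℕ} (Ω : Opens (Space N)) : Module.End ℝ 𝓓(Ω, ℝ) where
  toFun φ := ∑ i : Fin N, ∂_{coordVec i} (∂_{coordVec i} φ)
  map_add' φ χ := by simp [LineDeriv.lineDerivOp_add, Finset.sum_add_distrib]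
  map_smul' c φ := by simp [LineDeriv.lineDerivOp_smul, Finset.smul_sum]

/-- The polyharmonic operator `(-Δ)^m` on test functions. -/
def polyLaplacian {N : ℕ} (Ω : Opens (Space N)) (m : ℕ) : Module.End ℝ 𝓓(Ω, ℝ) :=
  (-testLaplacian Ω) ^ m

/-! ### The space `H^m_0(Ω)` -/

/-- Indices of the partial derivatives `∂_{i₁} ⋯ ∂_{i_r}`, `0 ≤ r ≤ m`. -/
abbrev JetIndex (N m : ℕ) : Type := Σ r : Fin (m + 1), (Fin (r : ℕ) → Fin N)

/-- The index of the derivative of order zero. -/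
def zeroIndex (N m : ℕ) : JetIndex N m := ⟨0, Fin.elim0⟩

/-- The Hilbert sum of copies of `L²(Ω)`, one for each partial derivative of order at most `m`. -/
abbrev JetSpace {N : ℕ} (Ω : Opens (Space N)) (m : ℕ) : Type :=
  PiLp 2 (fun _ : JetIndex N m => L2 Ω)

/-- The map `φ ↦ (∂_{i₁} ⋯ ∂_{i_r} φ)_{r ≤ m}`; the norm of the image is the `H^m`-norm of `φ`. -/
def jet {N : ℕ} (Ω : Opens (Space N)) (m : ℕ) : 𝓓(Ω, ℝ) →ₗ[ℝ] JetSpace Ω m where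
  toFun φ := WithLp.toLp 2 (fun i => testToL2 Ω (∂^{fun a => coordVec (i.2 a)} φ))
  map_add' φ χ := by
    ext1 i
    simp [LineDeriv.iteratedLineDerivOp_add]
  map_smul' c φ := by
    ext1 i
    simp [LineDeriv.iteratedLineDerivOp_smul]

/-- `H^m_0(Ω)`: the closure of `C_c^∞(Ω)` in the `H^m`-norm. An element is recorded together with
its weak derivatives of order at most `m`, which are the `L²`-limits of those of test functions. -/
def Hm0 {N : ℕ} (Ω : Opens (Space N)) (m : ℕ) : Submodule ℝ (JetSpace Ω m) :=
  (LinearMap.range (jet Ω m)).topologicalClosure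

/-- The function in `L²(Ω)` underlying an element of `H^m_0(Ω)`. -/
def toL2 {N : ℕ} {Ω : Opens (Space N)} {m : ℕ} : Hm0 Ω m →L[ℝ] L2 Ω :=
  (PiLp.proj 2 (fun _ : JetIndex N m => L2 Ω) (zeroIndex N m)).comp (Hm0 Ω m).subtypeL

/-- `∫_Ω u φ` for `u ∈ H^m_0(Ω)` and a test function `φ`. -/
def pairing {N : ℕ} {Ω : Opens (Space N)} {m : ℕ} (u : Hm0 Ω m) (φ : 𝓓(Ω, ℝ)) : ℝ :=
  ∫ x in (Ω : Set (Space N)), toL2 u x * φ x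

/-- `∫_Ω u v` for `u, v ∈ H^m_0(Ω)`. -/
def integralMul {N : ℕ} {Ω : Opens (Space N)} {m : ℕ} (u v : Hm0 Ω m) : ℝ :=
  ∫ x in (Ω : Set (Space N)), toL2 u x * toL2 v x

theorem pairing_eq_inner {N : ℕ} {Ω : Opens (Space N)} {m : ℕ} (u : Hm0 Ω m) (φ : 𝓓(Ω, ℝ)) :
    pairing u φ = inner ℝ (testToL2 Ω φ) (toL2 u) := by
  rw [pairing, L2.inner_def]
  refine integral_congr_ae ?_
  filter_upwards [(memLp_test Ω φ).coeFn_toLp] with x hx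
  have h : (testToL2 Ω φ) x = φ x := hx
  simp [h]

/-! ### Eigenvalues, equilibria and the linearization -/

/-- The eigenspace of `(-Δ)^m` with `m` zero Dirichlet conditions: the `u ∈ H^m_0(Ω)` with
`(-Δ)^m u = μ u` weakly in `Ω`. -/
def eigenspace {N : ℕ} (Ω : Opens (Space N)) (m : ℕ) (μ : ℝ) : Submodule ℝ (Hm0 Ω m) where
  carrier := {u | ∀ φ : 𝓓(Ω, ℝ), pairing u (polyLaplacian Ω m φ) = μ * pairing u φ}
  add_mem' {u v} hu hv φ := by
    have h1 := hu φ
    have h2 := hv φ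
    simp only [pairing_eq_inner, map_add, inner_add_right] at h1 h2 ⊢
    rw [h1, h2]; ring
  zero_mem' φ := by simp [pairing_eq_inner]
  smul_mem' c u hu φ := by
    have h1 := hu φ
    simp only [pairing_eq_inner, map_smul, inner_smul_right] at h1 ⊢
    rw [h1]; ring

/-- `μ` is an eigenvalue of `(-Δ)^m` with `m` zero Dirichlet conditions on `Ω`. -/
def IsDirichletEigenvalue {N : ℕ} (Ω : Opens (Space N)) (m : ℕ) (μ : ℝ) : Prop :=
  eigenspace Ω m μ ≠ ⊥

/-- The operator `V'(u) = -(-Δ)^m u + lam u - (∫_Ω u²) u`, as a distribution on `Ω`: the value at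
the test function `φ`. -/
def opV' {N : ℕ} {Ω : Opens (Space N)} {m : ℕ} (lam : ℝ) (u : Hm0 Ω m) (φ : 𝓓(Ω, ℝ)) : ℝ :=
  -pairing u (polyLaplacian Ω m φ) + lam * pairing u φ - integralMul u u * pairing u φ

/-- The set of equilibria: weak solutions `ψ ∈ H^m_0(Ω)` of `V'(ψ) = 0`. -/
def equilibria {N : ℕ} (Ω : Opens (Space N)) (m : ℕ) (lam : ℝ) : Set (Hm0 Ω m) :=
  {ψ | ∀ φ : 𝓓(Ω, ℝ), opV' lam ψ φ = 0}

/-- The linearization `V''(ψ)v`, as a distribution on `Ω`: the Fréchet derivative at `ψ` of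
`u ↦ V'(u)` in the direction `v`, evaluated at the test function `φ`. -/
def opV'' {N : ℕ} {Ω : Opens (Space N)} {m : ℕ} (lam : ℝ) (ψ v : Hm0 Ω m) (φ : 𝓓(Ω, ℝ)) : ℝ :=
  fderiv ℝ (fun u : Hm0 Ω m => opV' lam u φ) ψ v

/-- The kernel of `V''(ψ)` in `H^m_0(Ω)`. -/
def kerV'' {N : ℕ} {Ω : Opens (Space N)} {m : ℕ} (lam : ℝ) (ψ : Hm0 Ω m) :
    Submodule ℝ (Hm0 Ω m) where
  carrier := {v | ∀ φ : 𝓓(Ω, ℝ), opV'' lam ψ v φ = 0}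
  add_mem' {u v} hu hv φ := by
    have h1 := hu φ
    have h2 := hv φ
    simp only [opV'', map_add] at h1 h2 ⊢
    rw [h1, h2, add_zero]
  zero_mem' φ := by simp [opV'']
  smul_mem' c u hu φ := by
    have h1 := hu φ
    simp only [opV'', map_smul] at h1 ⊢
    rw [h1, smul_zero]

/-! ### Smooth submanifolds and the resonance branching hypothesis -/

/-- `S` is an embedded `C^∞` submanifold of dimension `k` of the normed space `E`: near each of its
points it is the image of an open subset of `ℝ^k` under a smooth immersion that is a homeomorphism
onto its image. -/
def IsSmoothSubmanifold {E : Type*} [NormedAddCommGroup E] [NormedSpace ℝ E]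
    (k : ℕ) (S : Set E) : Prop :=
  ∀ p ∈ S, ∃ (U : Set E) (W : Set (Space k)) (f : Space k → E) (g : E → Space k),
    IsOpen U ∧ p ∈ U ∧ IsOpen W ∧ f '' W = S ∩ U ∧
    ContDiffOn ℝ ∞ f W ∧ (∀ w ∈ W, Function.Injective (fderiv ℝ f w)) ∧
    ContinuousOn g (S ∩ U) ∧ ∀ w ∈ W, g (f w) = w

/-- Branching of equilibria occurs at `ψ`: it is an equilibrium which is not isolated in the set of
all equilibria. -/
def BranchingAt {N : ℕ} {Ω : Opens (Space N)} {m : ℕ} (lam : ℝ) (ψ : Hm0 Ω m) : Prop :=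
  ψ ∈ equilibria Ω m lam ∧ AccPt ψ (𝓟 (equilibria Ω m lam))

/-- The resonance branching hypothesis: wherever branching occurs at an equilibrium `ψ` with
`dim ker V''(ψ) = k ≥ 1`, the set of equilibria near `ψ` is a smooth `k`-dimensional manifold. -/
def ResonanceHypothesis {N : ℕ} (Ω : Opens (Space N)) (m : ℕ) (lam : ℝ) : Prop :=
  ∀ ψ : Hm0 Ω m, BranchingAt lam ψ →
    ∀ k : ℕ, 1 ≤ k → Module.finrank ℝ (kerV'' lam ψ) = k →
      ∃ U : Set (Hm0 Ω m), IsOpen U ∧ ψ ∈ U ∧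
        IsSmoothSubmanifold k (equilibria Ω m lam ∩ U)

end NonlocalResonance

end

/-!
On a function `ψ` the nonlinearity `(∫ ψ²) ψ` acts as multiplication by the scalar `‖ψ‖²`, so a
nonzero equilibrium is an eigenfunction of `(-Δ)^m` whose eigenvalue `μ` satisfies
`‖ψ‖² = λ_l - μ`: the equilibria are `0` and the `L²`-spheres of these radii in the eigenspaces.
Eigenfunctions for different eigenvalues are `L²`-orthogonal, hence an equilibrium at distance less
than `‖ψ‖` from `ψ` has the same eigenvalue, and so lies on the same sphere. Testing the linearized
equation with `ψ` itself identifies its kernel with the orthogonal complement of `ψ` in the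
eigenspace, which is the tangent space of the sphere.

What remains is that the eigenspaces are finite-dimensional and the eigenvalues do not accumulate,
so that no branching occurs at `0`. Among `L²`-orthonormal functions of energy at most `Λ`, each has
at least half of its Fourier mass in a fixed ball, while by Bessel's inequality applied to the
plane waves on `Ω` their densities sum to at most `|Ω|` at every frequency; this bounds their
number.
-/

noncomputable section

namespace NonlocalResonance

open scoped SchwartzMap FourierTransform Pointwise
open LineDeriv

section Submanifold

variable {E F : Type*} [NormedAddCommGroup E] [NormedSpace ℝ E]

theorem IsSmoothSubmanifold.inter_isOpen {k : ℕ} {S O : Set E} (hS : IsSmoothSubmanifold k S)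
    (hO : IsOpen O) : IsSmoothSubmanifold k (S ∩ O) := by
  rintro p ⟨hp, -⟩
  obtain ⟨U, W, f, g, hU, hpU, hW, hfW, hf, hinj, hg, hgf⟩ := hS p hp
  refine ⟨U, W ∩ f ⁻¹' O, f, g, hU, hpU, hf.continuousOn.isOpen_inter_preimage hW hO, ?_,
    hf.mono Set.inter_subset_left, fun w hw => hinj w hw.1,
    hg.mono (by gcongr; exact Set.inter_subset_left), fun w hw => hgf w hw.1⟩
  rw [Set.image_inter_preimage, hfW, Set.inter_right_comm]

theorem IsSmoothSubmanifold.image [NormedAddCommGroup F] [NormedSpace ℝ F] {k : ℕ} {S : Set F}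
    (hS : IsSmoothSubmanifold k S) {P : F →L[ℝ] E} (hP : P.HasLeftInverse) :
    IsSmoothSubmanifold k (P '' S) := by
  obtain ⟨A, hA⟩ := hP
  rintro _ ⟨p, hp, rfl⟩
  obtain ⟨U, W, f, g, hU, hpU, hW, hfW, hf, hinj, hg, hgf⟩ := hS p hp
  refine ⟨A ⁻¹' U, W, P ∘ f, g ∘ A, hU.preimage A.continuous, by simpa [hA p], hW, ?_,
    P.contDiff.comp_contDiffOn hf, fun w hw => ?_, ?_, fun w hw => by simp [hA (f w), hgf w hw]⟩
  · rw [Set.image_comp, hfW, ← Set.image_inter_preimage, ← Set.preimage_comp, hA.comp_eq_id,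
      Set.preimage_id]
  · have hfw : DifferentiableAt ℝ f w :=
      (hf.contDiffAt (hW.mem_nhds hw)).differentiableAt (by simp)
    rw [P.hasFDerivAt.comp w hfw.hasFDerivAt |>.fderiv]
    exact hA.injective.comp (hinj w hw)
  · refine hg.comp A.continuous.continuousOn ?_
    rintro _ ⟨⟨x, hx, rfl⟩, hxU⟩
    rw [Set.mem_preimage, hA x] at hxU
    rw [hA x]
    exact ⟨hx, hxU⟩

theorem injective_fderiv_of_leftInverse [NormedAddCommGroup F] [NormedSpace ℝ F] {f : F → E}
    {g : E → F} {w : F} (hf : DifferentiableAt ℝ f w) (hg : DifferentiableAt ℝ g (f w))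
    (hgf : Function.LeftInverse g f) : Function.Injective (fderiv ℝ f w) := by
  have hcomp : (fderiv ℝ g (f w)).comp (fderiv ℝ f w) = .id ℝ F := by
    rw [← fderiv_comp w hg hf, hgf.comp_eq_id, fderiv_id]
  exact Function.LeftInverse.injective (g := fderiv ℝ g (f w)) fun x => congr($hcomp x)

theorem hasLeftInverse_of_injective [NormedAddCommGroup F] [NormedSpace ℝ F] [FiniteDimensional ℝ F]
    {P : F →L[ℝ] E} (hP : Function.Injective P) : P.HasLeftInverse := by
  let e : F ≃ₗ[ℝ] LinearMap.range P.toLinearMap := LinearEquiv.ofInjective P.toLinearMap hP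
  obtain ⟨A, hA⟩ := (LinearMap.toContinuousLinearMap
    e.symm.toLinearMap).exist_extension_of_finiteDimensional_range
  exact ⟨A, fun x => by simpa [e] using congr($hA (e x)).symm⟩

variable [NormedAddCommGroup F] [InnerProductSpace ℝ F]

theorem isSmoothSubmanifold_unitSphere {k : ℕ} (hF : Module.finrank ℝ F = k + 1) :
    IsSmoothSubmanifold k (Metric.sphere (0 : F) 1) := by
  have : Fact (Module.finrank ℝ F = k + 1) := ⟨hF⟩
  have : FiniteDimensional ℝ F := .of_finrank_pos (by lia)
  intro p hp
  set v : F := -p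
  have hv : ‖v‖ = 1 := by rw [norm_neg, mem_sphere_zero_iff_norm.1 hp]
  have : IsAddTorsionFree F := .of_isTorsionFree ℝ F
  have hpv : p ≠ v := self_ne_neg.2 (norm_ne_zero_iff.1 (by simp [mem_sphere_zero_iff_norm.1 hp]))
  let τ : (ℝ ∙ v)ᗮ ≃ₗᵢ[ℝ] Space k :=
    (OrthonormalBasis.fromOrthogonalSpanSingleton k (norm_ne_zero_iff.1 (by simp [hv]))).repr
  let f : Space k → F := fun w => stereoInvFun hv (τ.symm w)
  let g : F → Space k := fun x => τ (stereoToFun v x)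
  have hf : ContDiff ℝ ∞ f := contDiff_stereoInvFunAux.comp
    ((ℝ ∙ v)ᗮ.subtypeL.contDiff.comp τ.symm.contDiff)
  have hgf : Function.LeftInverse g f := fun w => by
    simp only [f, g, stereo_right_inv, LinearIsometryEquiv.apply_symm_apply]
  have hfv : ∀ w, f w ≠ v := fun w h => stereoInvFun_ne_north_pole hv (τ.symm w) (Subtype.ext h)
  have hne : ∀ x ∈ Metric.sphere (0 : F) 1, x ≠ v → innerSL ℝ v x ≠ 1 := fun x hx hxv h =>
    hxv ((inner_eq_one_iff_of_norm_eq_one hv (mem_sphere_zero_iff_norm.1 hx)).1 h).symm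
  have hg : ContDiffOn ℝ ∞ g {x | innerSL ℝ v x ≠ 1} :=
    τ.contDiff.comp_contDiffOn contDiffOn_stereoToFun
  have hopen : IsOpen {x : F | innerSL ℝ v x ≠ 1} :=
    isOpen_ne_fun (innerSL ℝ v).continuous continuous_const
  refine ⟨{v}ᶜ, Set.univ, f, g, isOpen_compl_singleton, hpv, isOpen_univ, ?_, hf.contDiffOn,
    fun w _ => injective_fderiv_of_leftInverse (hf.differentiable (by simp) w)
      ((hg.contDiffAt (hopen.mem_nhds (hne _ (stereoInvFun hv _).2 (hfv w)))).differentiableAt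
        (by simp)) hgf,
    hg.continuousOn.mono fun x hx => hne x hx.1 hx.2, fun w _ => hgf w⟩
  ext x
  simp only [Set.image_univ, Set.mem_range]
  constructor
  · rintro ⟨w, rfl⟩
    exact ⟨(stereoInvFun hv _).2, hfv w⟩
  · rintro ⟨hx, hxv⟩
    refine ⟨g x, ?_⟩
    simp only [f, g, LinearIsometryEquiv.symm_apply_apply, stereo_left_inv hv (x := ⟨x, hx⟩) hxv]

theorem isSmoothSubmanifold_image_sphere {k : ℕ} (hF : Module.finrank ℝ F = k + 1) {P : F →L[ℝ] E}
    (hP : Function.Injective P) {r : ℝ} (hr : 0 < r) :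
    IsSmoothSubmanifold k (P '' Metric.sphere 0 r) := by
  have : FiniteDimensional ℝ F := .of_finrank_pos (by lia)
  have hrP : Function.Injective (r • P) := fun x y h => hP (smul_right_injective E hr.ne' h)
  have himage : P '' Metric.sphere 0 r = (r • P) '' Metric.sphere 0 1 := by
    have hsphere : Metric.sphere (0 : F) r = r • Metric.sphere (0 : F) 1 := by
      simp [smul_sphere' hr.ne', abs_of_pos hr]
    rw [hsphere, ← Set.image_smul, Set.image_image]
    simp
  rw [himage]
  exact (isSmoothSubmanifold_unitSphere hF).image (hasLeftInverse_of_injective hrP)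

end Submanifold

section LevelSphere

theorem connectedComponentIn_eq_of_inter_isOpen {X : Type*} [TopologicalSpace X] {F S O : Set X}
    {x : X} (hS : IsPreconnected S) (hSc : IsClosed S) (hO : IsOpen O) (hF : F ∩ O = S)
    (hx : x ∈ S) : connectedComponentIn F x = S := by
  have hSF : S ⊆ F := hF ▸ Set.inter_subset_left
  refine Set.Subset.antisymm ?_ (hS.subset_connectedComponentIn hx hSF)
  set C := connectedComponentIn F x
  have hCF : C ⊆ F := connectedComponentIn_subset F x
  have hcover : C ⊆ O ∪ Sᶜ := fun y _ => by
    by_cases hyS : y ∈ S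
    · exact .inl (hF.ge hyS).2
    · exact .inr hyS
  have hdisj : C ∩ (O ∩ Sᶜ) = ∅ :=
    Set.eq_empty_of_forall_notMem fun y hy => hy.2.2 (hF.le ⟨hCF hy.1, hy.2.1⟩)
  rcases isPreconnected_iff_subset_of_disjoint.1 isPreconnected_connectedComponentIn O Sᶜ hO
    hSc.isOpen_compl hcover hdisj with hCO | hCS
  · exact fun y hy => hF.le ⟨hCF hy, hCO hy⟩
  · exact absurd hx (hCS (mem_connectedComponentIn (hSF hx)))

variable {H L : Type*} [NormedAddCommGroup H] [NormedSpace ℝ H] [NormedAddCommGroup L]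
  [InnerProductSpace ℝ L] {T : H →L[ℝ] L} {V : Submodule ℝ H} {s : ℝ}

/-- The sphere `‖T u‖² = s` in the subspace `V`, where `‖T ·‖` plays the role of the `L²`-norm. -/
def levelSphere (T : H →L[ℝ] L) (V : Submodule ℝ H) (s : ℝ) : Set H :=
  {u | u ∈ V ∧ ‖T u‖ ^ 2 = s}

theorem exists_levelSphere_eq_image (hT : Function.Injective T) (V : Submodule ℝ H)
    [FiniteDimensional ℝ V] : ∃ P : V.map T.toLinearMap →L[ℝ] H, Function.Injective P ∧
      ∀ s, 0 ≤ s → levelSphere T V s = P '' Metric.sphere 0 √s := by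
  let e := V.equivMapOfInjective T.toLinearMap hT
  refine ⟨LinearMap.toContinuousLinearMap (V.subtype ∘ₗ e.symm.toLinearMap),
    V.injective_subtype.comp e.symm.injective, fun s hs => ?_⟩
  have hnorm : ∀ x : V, ‖e x‖ = ‖T x‖ := fun _ => rfl
  ext u
  constructor
  · rintro ⟨hu, hus⟩
    refine ⟨e ⟨u, hu⟩, ?_, by simp⟩
    rw [mem_sphere_zero_iff_norm, hnorm, ← hus, Real.sqrt_sq (norm_nonneg _)]
  · rintro ⟨y, hy, rfl⟩
    refine ⟨(e.symm y).2, ?_⟩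
    rw [mem_sphere_zero_iff_norm, ← e.apply_symm_apply y, hnorm] at hy
    simpa [hy] using Real.sq_sqrt hs

theorem finrank_map_of_injective (hT : Function.Injective T) (V : Submodule ℝ H) :
    Module.finrank ℝ (V.map T.toLinearMap) = Module.finrank ℝ V :=
  (V.equivMapOfInjective T.toLinearMap hT).finrank_eq.symm

theorem isSmoothSubmanifold_levelSphere (hT : Function.Injective T) {k : ℕ}
    (hV : Module.finrank ℝ V = k + 1) (hs : 0 < s) :
    IsSmoothSubmanifold k (levelSphere T V s) := by
  have : FiniteDimensional ℝ V := .of_finrank_pos (by lia)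
  obtain ⟨P, hP, himage⟩ := exists_levelSphere_eq_image hT V
  rw [himage s hs.le]
  exact isSmoothSubmanifold_image_sphere ((finrank_map_of_injective hT V).trans hV) hP
    (Real.sqrt_pos.2 hs)

theorem isPreconnected_levelSphere (hT : Function.Injective T) (hV : 1 < Module.finrank ℝ V)
    (hs : 0 ≤ s) : IsPreconnected (levelSphere T V s) := by
  have : FiniteDimensional ℝ V := .of_finrank_pos (by lia)
  obtain ⟨P, -, himage⟩ := exists_levelSphere_eq_image hT V
  rw [himage s hs]
  refine (isPreconnected_sphere ?_ _ _).image P P.continuous.continuousOn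
  exact_mod_cast Module.lt_rank_of_lt_finrank ((finrank_map_of_injective hT V).symm ▸ hV)

theorem isClosed_levelSphere [FiniteDimensional ℝ V] : IsClosed (levelSphere T V s) :=
  V.closed_of_finiteDimensional.inter (isClosed_eq (by fun_prop) continuous_const)

theorem map_ne_zero_of_mem_levelSphere {u : H} (hs : s ≠ 0) (hu : u ∈ levelSphere T V s) :
    T u ≠ 0 := fun h => hs (by rw [← hu.2, h]; simp)

theorem accPt_levelSphere (hT : Function.Injective T) (hV : 1 < Module.finrank ℝ V)
    (hs : 0 < s) {u : H} (hu : u ∈ levelSphere T V s) : AccPt u (𝓟 (levelSphere T V s)) := by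
  refine (isPreconnected_levelSphere hT hV hs.le).preperfect_of_nontrivial
    ⟨u, hu, -u, ⟨V.neg_mem hu.1, by simpa using hu.2⟩, ?_⟩ u hu
  have : IsAddTorsionFree H := .of_isTorsionFree ℝ H
  refine self_ne_neg.2 fun h => map_ne_zero_of_mem_levelSphere hs.ne' hu ?_
  rw [h, map_zero]

end LevelSphere

section SymmetricForm

variable {H L : Type*} [NormedAddCommGroup H] [NormedSpace ℝ H] [NormedAddCommGroup L]
  [InnerProductSpace ℝ L] {a : LinearMap.BilinForm ℝ H} {T : H →L[ℝ] L} {lam μ ν : ℝ} {u v ψ : H}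

/-- The solutions `u` of `a(u, ·) = μ ⟪T u, T ·⟫`. For the energy form of `(-Δ)^m` and the
inclusion `T` of `H^m_0` into `L²` these are the Dirichlet eigenfunctions. -/
def weakEigenspace (a : LinearMap.BilinForm ℝ H) (T : H →L[ℝ] L) (μ : ℝ) : Submodule ℝ H :=
  LinearMap.ker (a - μ • (innerₗ L).compl₁₂ T.toLinearMap T.toLinearMap)

theorem mem_weakEigenspace :
    u ∈ weakEigenspace a T μ ↔ ∀ v, a u v = μ * inner ℝ (T u) (T v) := by
  simp [weakEigenspace, LinearMap.ext_iff, sub_eq_zero]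

/-- The solutions `ψ` of `a(ψ, ·) = (lam - ‖T ψ‖²) ⟪T ψ, T ·⟫`: since the nonlinearity acts on `ψ`
as a scalar, an equilibrium is an eigenvector whose eigenvalue depends on its norm. -/
def weakEquilibria (a : LinearMap.BilinForm ℝ H) (T : H →L[ℝ] L) (lam : ℝ) : Set H :=
  {ψ | ψ ∈ weakEigenspace a T (lam - ‖T ψ‖ ^ 2)}

theorem mem_weakEquilibria :
    ψ ∈ weakEquilibria a T lam ↔ ψ ∈ weakEigenspace a T (lam - ‖T ψ‖ ^ 2) := Iff.rfl

/-- The kernel of the linearization at `ψ` of the equation that defines `weakEquilibria`. -/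
def weakKernel (a : LinearMap.BilinForm ℝ H) (T : H →L[ℝ] L) (lam : ℝ) (ψ : H) : Submodule ℝ H :=
  let B : LinearMap.BilinForm ℝ H := (innerₗ L).compl₁₂ T.toLinearMap T.toLinearMap
  LinearMap.ker (a - (lam - ‖T ψ‖ ^ 2) • B + 2 • (B ψ).smulRight (B ψ))

theorem mem_weakKernel :
    v ∈ weakKernel a T lam ψ ↔ ∀ w, a v w = (lam - ‖T ψ‖ ^ 2) * inner ℝ (T v) (T w)
      - 2 * inner ℝ (T ψ) (T v) * inner ℝ (T ψ) (T w) := by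
  simp only [weakKernel, LinearMap.mem_ker, LinearMap.ext_iff]
  refine forall_congr' fun w => ?_
  simp only [LinearMap.add_apply, LinearMap.sub_apply, LinearMap.smul_apply,
    LinearMap.coe_smulRight, LinearMap.compl₁₂_apply, ContinuousLinearMap.coe_coe,
    innerₗ_apply_apply, smul_eq_mul, nsmul_eq_mul, Nat.cast_ofNat, LinearMap.zero_apply]
  constructor <;> intro h <;> linarith

theorem apply_self_of_mem_weakEigenspace (hu : u ∈ weakEigenspace a T μ) :
    a u u = μ * ‖T u‖ ^ 2 := by
  rw [mem_weakEigenspace.1 hu, real_inner_self_eq_norm_sq]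

theorem inner_eq_zero_of_mem_weakEigenspace (ha : a.IsSymm) (hu : u ∈ weakEigenspace a T μ)
    (hv : v ∈ weakEigenspace a T ν) (hμν : μ ≠ ν) : inner ℝ (T u) (T v) = 0 := by
  have huv : a u v = μ * inner ℝ (T u) (T v) := mem_weakEigenspace.1 hu v
  have hvu : a u v = ν * inner ℝ (T u) (T v) := by
    rw [← ha.eq, mem_weakEigenspace.1 hv u, real_inner_comm]
  have : (μ - ν) * inner ℝ (T u) (T v) = 0 := by linarith
  exact (mul_eq_zero.1 this).resolve_left (sub_ne_zero.2 hμν)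

theorem eq_of_norm_sub_lt_of_mem_weakEigenspace (ha : a.IsSymm) (hu : u ∈ weakEigenspace a T μ)
    (hv : v ∈ weakEigenspace a T ν) (h : ‖T v - T u‖ < ‖T u‖) : ν = μ := by
  by_contra hne
  have hpyth := norm_sub_sq_real (T v) (T u)
  rw [inner_eq_zero_of_mem_weakEigenspace ha hv hu hne] at hpyth
  nlinarith [norm_nonneg (T v - T u), norm_nonneg (T u), sq_nonneg ‖T v‖]

theorem mem_weakEquilibria_iff_of_mem_weakEigenspace (hT : Function.Injective T)
    (hu : u ∈ weakEigenspace a T μ) :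
    u ∈ weakEquilibria a T lam ↔ u = 0 ∨ ‖T u‖ ^ 2 = lam - μ := by
  constructor
  · intro h
    have hself := (apply_self_of_mem_weakEigenspace hu).symm.trans
      (apply_self_of_mem_weakEigenspace h)
    have : ‖T u‖ ^ 2 * (‖T u‖ ^ 2 - (lam - μ)) = 0 := by linarith
    refine (mul_eq_zero.1 this).imp (fun h0 => hT ?_) sub_eq_zero.1
    rw [map_zero, norm_eq_zero.1 (pow_eq_zero_iff two_ne_zero |>.1 h0)]
  · rintro (rfl | h)
    · exact (weakEigenspace a T _).zero_mem
    · rwa [mem_weakEquilibria, h, sub_sub_cancel]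

theorem levelSphere_subset_weakEquilibria :
    levelSphere T (weakEigenspace a T μ) (lam - μ) ⊆ weakEquilibria a T lam := by
  rintro u ⟨hu, hus⟩
  rwa [mem_weakEquilibria, hus, sub_sub_cancel]

theorem mem_levelSphere_of_mem_weakEquilibria (hψ : ψ ∈ weakEquilibria a T lam)
    (hμ : μ = lam - ‖T ψ‖ ^ 2) : ψ ∈ levelSphere T (weakEigenspace a T μ) (lam - μ) := by
  subst hμ
  exact ⟨hψ, (sub_sub_cancel _ _).symm⟩

theorem mem_weakEquilibria_iff_mem_levelSphere (ha : a.IsSymm)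
    (hu : u ∈ levelSphere T (weakEigenspace a T μ) (lam - μ)) (h : ‖T ψ - T u‖ < ‖T u‖) :
    ψ ∈ weakEquilibria a T lam ↔ ψ ∈ levelSphere T (weakEigenspace a T μ) (lam - μ) :=
  ⟨fun hψ => mem_levelSphere_of_mem_weakEquilibria hψ
    (eq_of_norm_sub_lt_of_mem_weakEigenspace ha hu.1 hψ h).symm,
    fun hψ => levelSphere_subset_weakEquilibria hψ⟩

theorem connectedComponentIn_weakEquilibria (ha : a.IsSymm) (hT : Function.Injective T)
    (hV : 1 < Module.finrank ℝ (weakEigenspace a T μ)) (hμ : μ < lam)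
    (hu : u ∈ levelSphere T (weakEigenspace a T μ) (lam - μ)) :
    connectedComponentIn (weakEquilibria a T lam) u =
      levelSphere T (weakEigenspace a T μ) (lam - μ) := by
  set S := levelSphere T (weakEigenspace a T μ) (lam - μ)
  have : FiniteDimensional ℝ (weakEigenspace a T μ) := .of_finrank_pos (by lia)
  have hTS : ∀ x ∈ S, T x ≠ 0 := fun x => map_ne_zero_of_mem_levelSphere (sub_pos.2 hμ).ne'
  refine connectedComponentIn_eq_of_inter_isOpen (isPreconnected_levelSphere hT hV
    (sub_pos.2 hμ).le) isClosed_levelSphere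
    (O := ⋃ x ∈ S, T ⁻¹' Metric.ball (T x) ‖T x‖) (isOpen_biUnion fun x _ =>
      Metric.isOpen_ball.preimage T.continuous) ?_ hu
  ext ψ
  simp only [Set.mem_inter_iff, Set.mem_iUnion, Set.mem_preimage, mem_ball_iff_norm]
  constructor
  · rintro ⟨hψ, x, hx, hψx⟩
    exact (mem_weakEquilibria_iff_mem_levelSphere ha hx hψx).1 hψ
  · exact fun hψ => ⟨levelSphere_subset_weakEquilibria hψ, ψ, hψ,
      by simpa using hTS ψ hψ⟩

theorem mem_weakKernel_iff_of_mem_weakEquilibria (ha : a.IsSymm)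
    (hψ : ψ ∈ weakEquilibria a T lam) : v ∈ weakKernel a T lam ψ ↔
      v ∈ weakEigenspace a T (lam - ‖T ψ‖ ^ 2) ∧ inner ℝ (T ψ) (T v) = 0 := by
  rw [mem_weakKernel, mem_weakEigenspace]
  constructor
  · intro hv
    have horth : inner ℝ (T ψ) (T v) = 0 := by
      have hvψ := hv ψ
      rw [← ha.eq, mem_weakEigenspace.1 hψ v, real_inner_self_eq_norm_sq,
        real_inner_comm (T ψ) (T v)] at hvψ
      have : inner ℝ (T ψ) (T v) * ‖T ψ‖ ^ 2 = 0 := by linarith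
      rcases mul_eq_zero.1 this with h | h
      · exact h
      · rw [norm_eq_zero.1 (pow_eq_zero_iff two_ne_zero |>.1 h), inner_zero_left]
    exact ⟨fun w => by rw [hv, horth]; ring, horth⟩
  · rintro ⟨hv, horth⟩ w
    rw [hv, horth]
    ring

theorem weakKernel_le_weakEigenspace (ha : a.IsSymm) (hψ : ψ ∈ weakEquilibria a T lam) :
    weakKernel a T lam ψ ≤ weakEigenspace a T (lam - ‖T ψ‖ ^ 2) := fun _ hv =>
  ((mem_weakKernel_iff_of_mem_weakEquilibria ha hψ).1 hv).1

theorem finrank_weakKernel_add_one (ha : a.IsSymm) (hψ : ψ ∈ weakEquilibria a T lam)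
    (hTψ : T ψ ≠ 0) [FiniteDimensional ℝ (weakEigenspace a T (lam - ‖T ψ‖ ^ 2))] :
    Module.finrank ℝ (weakKernel a T lam ψ) + 1 =
      Module.finrank ℝ (weakEigenspace a T (lam - ‖T ψ‖ ^ 2)) := by
  set V := weakEigenspace a T (lam - ‖T ψ‖ ^ 2)
  let ℓ : Module.Dual ℝ V := innerₗ L (T ψ) ∘ₗ T.toLinearMap ∘ₗ V.subtype
  have hℓ : ℓ ≠ 0 := fun h => hTψ (inner_self_eq_zero.1 congr($h ⟨ψ, hψ⟩))
  have hker : (weakKernel a T lam ψ).comap V.subtype = LinearMap.ker ℓ := by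
    ext v
    simp [mem_weakKernel_iff_of_mem_weakEquilibria ha hψ, ℓ, V]
  rw [← Module.Dual.finrank_ker_add_one_of_ne_zero hℓ, ← hker,
    (Submodule.comapSubtypeEquivOfLe (weakKernel_le_weakEigenspace ha hψ)).finrank_eq]

theorem finrank_weakKernel_of_mem_levelSphere (ha : a.IsSymm) {k : ℕ}
    (hV : Module.finrank ℝ (weakEigenspace a T μ) = k + 1) (hμ : μ ≠ lam)
    (hu : u ∈ levelSphere T (weakEigenspace a T μ) (lam - μ)) :
    Module.finrank ℝ (weakKernel a T lam u) = k := by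
  have hnorm : lam - ‖T u‖ ^ 2 = μ := by rw [hu.2, sub_sub_cancel]
  have : FiniteDimensional ℝ (weakEigenspace a T (lam - ‖T u‖ ^ 2)) := by
    rw [hnorm]
    exact .of_finrank_pos (by lia)
  have hdim := finrank_weakKernel_add_one ha (levelSphere_subset_weakEquilibria hu)
    (map_ne_zero_of_mem_levelSphere (sub_ne_zero.2 hμ.symm) hu)
  rw [hnorm, hV] at hdim
  lia

theorem exists_isSmoothSubmanifold_weakEquilibria_inter (ha : a.IsSymm)
    (hT : Function.Injective T) (hψ : ψ ∈ weakEquilibria a T lam) (hψ0 : ψ ≠ 0)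
    [FiniteDimensional ℝ (weakEigenspace a T (lam - ‖T ψ‖ ^ 2))] :
    ∃ U, IsOpen U ∧ ψ ∈ U ∧ IsSmoothSubmanifold (Module.finrank ℝ (weakKernel a T lam ψ))
      (weakEquilibria a T lam ∩ U) := by
  have hTψ : T ψ ≠ 0 := (map_ne_zero_iff T hT).2 hψ0
  set S := levelSphere T (weakEigenspace a T (lam - ‖T ψ‖ ^ 2)) (lam - (lam - ‖T ψ‖ ^ 2))
  have hψS : ψ ∈ S := mem_levelSphere_of_mem_weakEquilibria hψ rfl
  have hS : IsSmoothSubmanifold (Module.finrank ℝ (weakKernel a T lam ψ)) S :=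
    isSmoothSubmanifold_levelSphere hT (finrank_weakKernel_add_one ha hψ hTψ).symm
      (by rw [sub_sub_cancel]; positivity)
  let U := T ⁻¹' Metric.ball (T ψ) ‖T ψ‖
  have hU : IsOpen U := Metric.isOpen_ball.preimage T.continuous
  refine ⟨U, hU, by simpa [U] using hTψ, ?_⟩
  have hSU : weakEquilibria a T lam ∩ U = S ∩ U := by
    ext χ
    refine and_congr_left fun hχ => mem_weakEquilibria_iff_mem_levelSphere ha hψS ?_
    rwa [← mem_ball_iff_norm]
  rw [hSU]
  exact hS.inter_isOpen hU

/-- The number of eigenvalues up to any level `Λ`, counted with multiplicity, is finite; it is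
stated for arbitrary `T`-orthonormal vectors, so that no spectral theorem is needed to verify it. -/
def HasFiniteCounting (a : LinearMap.BilinForm ℝ H) (T : H →L[ℝ] L) : Prop :=
  ∀ Λ : ℝ, ∃ M : ℕ, ∀ (n : ℕ) (u : Fin n → H), (Orthonormal ℝ fun i => T (u i)) →
    (∀ i, a (u i) (u i) ≤ Λ) → n ≤ M

theorem finiteDimensional_of_orthonormal_card_le {M : ℕ}
    (h : ∀ (n : ℕ) (e : Fin n → L), Orthonormal ℝ e → n ≤ M) : FiniteDimensional ℝ L := by
  have hrank : Module.rank ℝ L ≤ M := rank_le fun s hs => by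
    rw [← finrank_span_finset_eq_card hs]
    exact h _ _ ((stdOrthonormalBasis ℝ (Submodule.span ℝ (s : Set L))).orthonormal
      |>.comp_linearIsometry (Submodule.subtypeₗᵢ _))
  exact Module.rank_lt_aleph0_iff.1 (hrank.trans_lt Cardinal.natCast_lt_aleph0)

theorem HasFiniteCounting.finiteDimensional_weakEigenspace (hcount : HasFiniteCounting a T)
    (hT : Function.Injective T) (μ : ℝ) : FiniteDimensional ℝ (weakEigenspace a T μ) := by
  obtain ⟨M, hM⟩ := hcount μ
  have : FiniteDimensional ℝ ((weakEigenspace a T μ).map T.toLinearMap) := by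
    refine finiteDimensional_of_orthonormal_card_le (M := M) fun n e he => ?_
    choose u hu hue using fun i => (e i).2
    have hue : (fun i => T (u i)) = fun i => (e i : L) := funext hue
    have horth : Orthonormal ℝ fun i => T (u i) :=
      hue ▸ he.comp_linearIsometry (Submodule.subtypeₗᵢ _)
    refine hM n u horth fun i => ?_
    rw [apply_self_of_mem_weakEigenspace (hu i), horth.1 i]
    simp
  exact ((weakEigenspace a T μ).equivMapOfInjective T.toLinearMap hT).symm.finiteDimensional

theorem HasFiniteCounting.finite_eigenvalues_le (hcount : HasFiniteCounting a T) (ha : a.IsSymm)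
    (hT : Function.Injective T) (Λ : ℝ) : {μ | weakEigenspace a T μ ≠ ⊥ ∧ μ ≤ Λ}.Finite := by
  obtain ⟨M, hM⟩ := hcount Λ
  have hunit : ∀ μ : {μ | weakEigenspace a T μ ≠ ⊥ ∧ μ ≤ Λ},
      ∃ u ∈ weakEigenspace a T μ.1, ‖T u‖ = 1 := by
    rintro ⟨μ, hμ, -⟩
    obtain ⟨u, hu, hu0⟩ := Submodule.exists_mem_ne_zero_of_ne_bot hμ
    refine ⟨‖T u‖⁻¹ • u, Submodule.smul_mem _ _ hu, ?_⟩
    simpa using norm_smul_inv_norm (𝕜 := ℝ) ((map_ne_zero_iff T hT).2 hu0)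
  choose u hu hnorm using hunit
  by_contra hinf
  have := Set.infinite_coe_iff.2 hinf
  let ι : Fin (M + 1) ↪ {μ | weakEigenspace a T μ ≠ ⊥ ∧ μ ≤ Λ} :=
    Fin.valEmbedding.trans (Infinite.natEmbedding _)
  have horth : Orthonormal ℝ fun i => T (u (ι i)) := by
    refine ⟨fun i => hnorm _, fun i j hij => ?_⟩
    exact inner_eq_zero_of_mem_weakEigenspace ha (hu _) (hu _)
      (Subtype.coe_injective.ne (ι.injective.ne hij))
  have := hM (M + 1) (fun i => u (ι i)) horth fun i => by
    rw [apply_self_of_mem_weakEigenspace (hu _), hnorm]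
    simpa using (ι i).2.2
  lia

theorem HasFiniteCounting.not_accPt_zero_weakEquilibria (hcount : HasFiniteCounting a T)
    (ha : a.IsSymm) (hT : Function.Injective T) (lam : ℝ) :
    ¬ AccPt (0 : H) (𝓟 (weakEquilibria a T lam)) := by
  rw [accPt_iff_frequently, not_frequently]
  have hfin : ({μ | weakEigenspace a T μ ≠ ⊥ ∧ μ ≤ lam} \ {lam}).Finite :=
    (hcount.finite_eigenvalues_le ha hT lam).sdiff
  have hcont : Tendsto (fun ψ => lam - ‖T ψ‖ ^ 2) (𝓝 0) (𝓝 lam) := by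
    have h : Continuous fun ψ => lam - ‖T ψ‖ ^ 2 := by fun_prop
    simpa using h.tendsto 0
  filter_upwards [hcont.eventually (hfin.isClosed.isOpen_compl.mem_nhds (x := lam) (by simp))]
    with ψ hψ
  rintro ⟨hψ0, hψE⟩
  have hpos : 0 < ‖T ψ‖ ^ 2 := by
    have := (map_ne_zero_iff T hT).2 hψ0
    positivity
  exact hψ ⟨⟨(Submodule.ne_bot_iff _).2 ⟨ψ, hψE, hψ0⟩, by linarith⟩, by simp [hpos.ne']⟩

end SymmetricForm

section OrthonormalCombination

variable {H L ι : Type*} [NormedAddCommGroup H] [NormedSpace ℝ H] [NormedAddCommGroup L]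
  [InnerProductSpace ℝ L] {a : LinearMap.BilinForm ℝ H} {T : H →L[ℝ] L} {e : ι → H}
  {V : Submodule ℝ H} {lam μ : ℝ}

theorem linearIndependent_of_orthonormal_map (he : Orthonormal ℝ fun i => T (e i)) :
    LinearIndependent ℝ e :=
  .of_comp T.toLinearMap he.linearIndependent

variable [Fintype ι]

theorem inner_map_sum_smul (he : Orthonormal ℝ fun i => T (e i)) (b c : ι → ℝ) :
    inner ℝ (T (∑ i, b i • e i)) (T (∑ i, c i • e i)) = ∑ i, b i * c i := by
  simpa using he.inner_sum b c Finset.univ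

theorem norm_map_sum_smul_sq (he : Orthonormal ℝ fun i => T (e i)) (c : ι → ℝ) :
    ‖T (∑ i, c i • e i)‖ ^ 2 = ∑ i, c i ^ 2 := by
  rw [← real_inner_self_eq_norm_sq, inner_map_sum_smul he]
  simp only [sq]

theorem mem_iff_exists_sum_smul [Nonempty ι] (he : Orthonormal ℝ fun i => T (e i))
    (heV : ∀ i, e i ∈ V) (hV : Module.finrank ℝ V = Fintype.card ι) {u : H} :
    u ∈ V ↔ ∃ c : ι → ℝ, u = ∑ i, c i • e i := by
  have hspan : Submodule.span ℝ (Set.range e) = V := by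
    have : FiniteDimensional ℝ V := .of_finrank_pos (hV ▸ Fintype.card_pos)
    exact Submodule.eq_of_le_of_finrank_eq (Submodule.span_le.2 (Set.range_subset_iff.2 heV))
      ((finrank_span_eq_card (linearIndependent_of_orthonormal_map he)).trans hV.symm)
  rw [← hspan, Submodule.mem_span_range_iff_exists_fun]
  simp only [eq_comm]

theorem levelSphere_eq_sum_smul [Nonempty ι] (he : Orthonormal ℝ fun i => T (e i))
    (heV : ∀ i, e i ∈ V) (hV : Module.finrank ℝ V = Fintype.card ι) (s : ℝ) :
    levelSphere T V s = {u | ∃ c : ι → ℝ, ∑ i, c i ^ 2 = s ∧ u = ∑ i, c i • e i} := by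
  ext u
  constructor
  · rintro ⟨hu, hus⟩
    obtain ⟨c, rfl⟩ := (mem_iff_exists_sum_smul he heV hV).1 hu
    exact ⟨c, norm_map_sum_smul_sq he c ▸ hus, rfl⟩
  · rintro ⟨c, hc, rfl⟩
    exact ⟨sum_mem fun i _ => V.smul_mem _ (heV i), (norm_map_sum_smul_sq he c).trans hc⟩

theorem sum_smul_mem_weakEquilibria_iff (hT : Function.Injective T)
    (he : Orthonormal ℝ fun i => T (e i)) (heV : ∀ i, e i ∈ weakEigenspace a T μ) (c : ι → ℝ) :
    ∑ i, c i • e i ∈ weakEquilibria a T lam ↔ c = 0 ∨ ∑ i, c i ^ 2 = lam - μ := by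
  rw [mem_weakEquilibria_iff_of_mem_weakEigenspace hT
    (sum_mem fun i _ => Submodule.smul_mem _ _ (heV i)), norm_map_sum_smul_sq he]
  refine or_congr_left ⟨fun h => funext ?_, by rintro rfl; simp⟩
  exact Fintype.linearIndependent_iff.1 (linearIndependent_of_orthonormal_map he) c h

theorem mem_weakKernel_sum_smul_iff [Nonempty ι] (ha : a.IsSymm)
    (he : Orthonormal ℝ fun i => T (e i)) (heV : ∀ i, e i ∈ weakEigenspace a T μ)
    (hV : Module.finrank ℝ (weakEigenspace a T μ) = Fintype.card ι) {c : ι → ℝ}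
    (hc : ∑ i, c i ^ 2 = lam - μ) {v : H} : v ∈ weakKernel a T lam (∑ i, c i • e i) ↔
      ∃ b : ι → ℝ, ∑ i, b i * c i = 0 ∧ v = ∑ i, b i • e i := by
  have hu : ∑ i, c i • e i ∈ levelSphere T (weakEigenspace a T μ) (lam - μ) :=
    (levelSphere_eq_sum_smul he heV hV _).ge ⟨c, hc, rfl⟩
  rw [mem_weakKernel_iff_of_mem_weakEquilibria ha (levelSphere_subset_weakEquilibria hu), hu.2,
    sub_sub_cancel, mem_iff_exists_sum_smul he heV hV]
  constructor
  · rintro ⟨⟨b, rfl⟩, hb⟩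
    exact ⟨b, by rwa [real_inner_comm, inner_map_sum_smul he] at hb, rfl⟩
  · rintro ⟨b, hb, rfl⟩
    exact ⟨⟨b, rfl⟩, by rwa [real_inner_comm, inner_map_sum_smul he]⟩

end OrthonormalCombination

section Plancherel

variable {V : Type*} [NormedAddCommGroup V] [InnerProductSpace ℝ V] [FiniteDimensional ℝ V]
  [MeasurableSpace V] [BorelSpace V]

theorem integrable_inner_schwartz (f g : 𝓢(V, ℂ)) :
    Integrable fun x => inner ℝ (f x) (g x) := by
  refine (L2.integrable_inner (𝕜 := ℝ) (f.toLp 2) (g.toLp 2)).congr ?_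
  filter_upwards [f.coeFn_toLp 2, g.coeFn_toLp 2] with x hf hg
  rw [hf, hg]

theorem integral_real_inner_fourier_fourier (f g : 𝓢(V, ℂ)) :
    ∫ ξ, inner ℝ (𝓕 f ξ) (𝓕 g ξ) = ∫ x, inner ℝ (f x) (g x) := by
  have hre : ∀ f g : 𝓢(V, ℂ),
      ∫ x, inner ℝ (f x) (g x) = RCLike.re (∫ x, inner ℂ (f x) (g x)) := fun f g => by
    rw [← integral_re]
    · rfl
    · refine (L2.integrable_inner (𝕜 := ℂ) (f.toLp 2) (g.toLp 2)).congr ?_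
      filter_upwards [f.coeFn_toLp 2, g.coeFn_toLp 2] with x hf hg
      rw [hf, hg]
  rw [hre, hre, SchwartzMap.integral_inner_fourier_fourier]

theorem fourier_lineDerivOp_apply (v : V) (f : 𝓢(V, ℂ)) (ξ : V) :
    𝓕 (∂_{v} f) ξ = 2 * Real.pi * Complex.I * inner ℝ ξ v * 𝓕 f ξ := by
  have hv : (fun ξ : V => inner ℝ ξ v).HasTemperateGrowth := by fun_prop
  rw [SchwartzMap.fourier_lineDerivOp_eq, smul_apply, SchwartzMap.smulLeftCLM_apply_apply hv,
    smul_eq_mul, Complex.real_smul]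
  ring

theorem inner_fourier_iteratedLineDerivOp {r : ℕ} (w : Fin r → V) (f g : 𝓢(V, ℂ))
    (ξ : V) : inner ℝ (𝓕 (∂^{w} f) ξ) (𝓕 (∂^{w} g) ξ) =
      (∏ a, (2 * Real.pi * inner ℝ ξ (w a)) ^ 2) * inner ℝ (𝓕 f ξ) (𝓕 g ξ) := by
  induction r with
  | zero => simp
  | succ r ih =>
    rw [iteratedLineDerivOp_succ_left, iteratedLineDerivOp_succ_left, fourier_lineDerivOp_apply,
      fourier_lineDerivOp_apply, Fin.prod_univ_succ]
    have hw := ih (Fin.tail w)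
    simp only [Fin.tail] at hw
    rw [mul_assoc (_ ^ 2), ← hw]
    simp [Complex.inner]
    ring

end Plancherel

section TestFunctions

variable {N : ℕ} {Ω : Opens (Space N)}

theorem inner_coordVec (ξ : Space N) (i : Fin N) : inner ℝ ξ (coordVec i) = ξ i := by
  simp [coordVec, EuclideanSpace.inner_single_right]

theorem sum_inner_fourier_iteratedLineDerivOp (m : ℕ) (f g : 𝓢(Space N, ℂ)) (ξ : Space N) :
    ∑ w : Fin m → Fin N, inner ℝ (𝓕 (∂^{fun a => coordVec (w a)} f) ξ)
        (𝓕 (∂^{fun a => coordVec (w a)} g) ξ) =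
      ((2 * Real.pi * ‖ξ‖) ^ 2) ^ m * inner ℝ (𝓕 f ξ) (𝓕 g ξ) := by
  simp only [inner_fourier_iteratedLineDerivOp, inner_coordVec]
  rw [← Finset.sum_mul, ← Fintype.sum_pow (fun i => (2 * Real.pi * ξ i) ^ 2), mul_pow,
    EuclideanSpace.norm_sq_eq, Finset.mul_sum]
  simp [mul_pow]

/-- A real test function as a complex-valued Schwartz function. -/
def toSchwartz (Ω : Opens (Space N)) : 𝓓(Ω, ℝ) →ₗ[ℝ] 𝓢(Space N, ℂ) where
  toFun φ := HasCompactSupport.toSchwartzMap (f := fun x => (φ x : ℂ))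
    (φ.hasCompactSupport.comp_left (g := ((↑) : ℝ → ℂ)) Complex.ofReal_zero)
    (Complex.ofRealCLM.contDiff.comp φ.contDiff)
  map_add' φ χ := SchwartzMap.ext fun x => Complex.ofReal_add (φ x) (χ x)
  map_smul' c φ := SchwartzMap.ext fun x =>
    (Complex.ofReal_mul c (φ x)).trans Complex.real_smul.symm

@[simp]
theorem toSchwartz_apply (φ : 𝓓(Ω, ℝ)) (x : Space N) : toSchwartz Ω φ x = φ x := rfl

theorem lineDerivOp_test_apply (v : Space N) (φ : 𝓓(Ω, ℝ)) (x : Space N) :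
    (∂_{v} φ : 𝓓(Ω, ℝ)) x = fderiv ℝ φ x v := by
  rw [TestFunction.lineDerivOp_eq_lineDerivCLM ℝ, TestFunction.lineDerivCLM_apply_of_le (by simp)]
  exact ((φ.contDiff.differentiable (by simp)).differentiableAt).lineDeriv_eq_fderiv

theorem toSchwartz_lineDerivOp (v : Space N) (φ : 𝓓(Ω, ℝ)) :
    toSchwartz Ω (∂_{v} φ) = ∂_{v} (toSchwartz Ω φ) := by
  ext x
  have hφ : HasFDerivAt φ (fderiv ℝ φ x) x :=
    ((φ.contDiff.differentiable (by simp)).differentiableAt).hasFDerivAt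
  have hφℂ : HasFDerivAt (toSchwartz Ω φ) (Complex.ofRealCLM.comp (fderiv ℝ φ x)) x :=
    Complex.ofRealCLM.hasFDerivAt.comp x hφ
  rw [SchwartzMap.lineDerivOp_apply_eq_fderiv, toSchwartz_apply, lineDerivOp_test_apply,
    hφℂ.fderiv]
  rfl

theorem toSchwartz_iteratedLineDerivOp {r : ℕ} (w : Fin r → Space N) (φ : 𝓓(Ω, ℝ)) :
    toSchwartz Ω (∂^{w} φ) = ∂^{w} (toSchwartz Ω φ) := by
  induction r with
  | zero => rfl
  | succ r ih => rw [iteratedLineDerivOp_succ_left, iteratedLineDerivOp_succ_left,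
      toSchwartz_lineDerivOp, ih]

theorem fourier_toSchwartz_polyLaplacian (m : ℕ) (φ : 𝓓(Ω, ℝ)) (ξ : Space N) :
    𝓕 (toSchwartz Ω (polyLaplacian Ω m φ)) ξ =
      (((2 * Real.pi * ‖ξ‖) ^ 2) ^ m : ℝ) * 𝓕 (toSchwartz Ω φ) ξ := by
  have hlap : ∀ χ, 𝓕 (toSchwartz Ω ((-testLaplacian Ω) χ)) ξ =
      ((2 * Real.pi * ‖ξ‖) ^ 2 : ℝ) * 𝓕 (toSchwartz Ω χ) ξ := fun χ => by
    have : (-testLaplacian Ω) χ = -∑ i, ∂_{coordVec i} (∂_{coordVec i} χ) := rfl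
    simp only [this, map_neg, map_sum, toSchwartz_lineDerivOp, FourierTransform.fourier_neg,
      FourierTransform.fourier_sum, neg_apply, sum_apply, fourier_lineDerivOp_apply,
      inner_coordVec, mul_pow, EuclideanSpace.norm_sq_eq, Real.norm_eq_abs, sq_abs]
    push_cast
    rw [Finset.mul_sum, Finset.sum_mul, ← Finset.sum_neg_distrib]
    refine Finset.sum_congr rfl fun i _ => ?_
    linear_combination (-4 * Real.pi ^ 2 * ξ i ^ 2 * 𝓕 (toSchwartz Ω χ) ξ) * Complex.I_sq
  induction m with
  | zero => simp [polyLaplacian]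
  | succ m ih =>
    rw [polyLaplacian, pow_succ', Module.End.mul_apply, hlap, ← polyLaplacian, ih, ← mul_assoc,
      ← Complex.ofReal_mul, ← pow_succ']

theorem support_test_subset (φ : 𝓓(Ω, ℝ)) : Function.support φ ⊆ (Ω : Set (Space N)) :=
  (subset_tsupport _).trans φ.tsupport_subset

theorem testToL2_coeFn (φ : 𝓓(Ω, ℝ)) :
    testToL2 Ω φ =ᵐ[volume.restrict (Ω : Set (Space N))] φ := (memLp_test Ω φ).coeFn_toLp

theorem inner_testToL2_eq_setIntegral (φ : 𝓓(Ω, ℝ)) (f : L2 Ω) :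
    inner ℝ (testToL2 Ω φ) f = ∫ x in Ω, φ x * f x := by
  rw [L2.inner_def]
  refine integral_congr_ae ?_
  filter_upwards [testToL2_coeFn φ] with x hx
  simp [hx, mul_comm]

theorem inner_testToL2 (φ χ : 𝓓(Ω, ℝ)) :
    inner ℝ (testToL2 Ω φ) (testToL2 Ω χ) = ∫ x, inner ℝ (toSchwartz Ω φ x) (toSchwartz Ω χ x) := by
  rw [inner_testToL2_eq_setIntegral]
  refine Eq.trans ?_ (setIntegral_eq_integral_of_forall_compl_eq_zero
    (s := (Ω : Set (Space N))) fun x hx => ?_)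
  · refine integral_congr_ae ?_
    filter_upwards [testToL2_coeFn χ] with x hx
    simp [hx, mul_comm]
  · have : φ x = 0 := Function.notMem_support.1 fun h => hx (support_test_subset φ h)
    simp [this]

theorem inner_testToL2_eq_integral_fourier (φ χ : 𝓓(Ω, ℝ)) :
    inner ℝ (testToL2 Ω φ) (testToL2 Ω χ) =
      ∫ ξ, inner ℝ (𝓕 (toSchwartz Ω φ) ξ) (𝓕 (toSchwartz Ω χ) ξ) := by
  rw [inner_testToL2, integral_real_inner_fourier_fourier]

theorem inner_testToL2_lineDerivOp (v : Space N) (φ χ : 𝓓(Ω, ℝ)) :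
    inner ℝ (testToL2 Ω φ) (testToL2 Ω (∂_{v} χ)) =
      -inner ℝ (testToL2 Ω (∂_{v} φ)) (testToL2 Ω χ) := by
  simp only [inner_testToL2_eq_integral_fourier, toSchwartz_lineDerivOp,
    fourier_lineDerivOp_apply, ← integral_neg]
  congr with ξ
  simp [Complex.inner]
  ring

theorem exists_inner_testToL2_iteratedLineDerivOp {r : ℕ} (w : Fin r → Space N) (χ : 𝓓(Ω, ℝ)) :
    ∃ η : 𝓓(Ω, ℝ), ∀ φ, inner ℝ (testToL2 Ω χ) (testToL2 Ω (∂^{w} φ)) =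
      inner ℝ (testToL2 Ω η) (testToL2 Ω φ) := by
  induction r generalizing χ with
  | zero => exact ⟨χ, fun φ => rfl⟩
  | succ r ih =>
    obtain ⟨η, hη⟩ := ih (Fin.tail w) (-∂_{w 0} χ)
    refine ⟨η, fun φ => ?_⟩
    rw [← hη, iteratedLineDerivOp_succ_left, inner_testToL2_lineDerivOp, map_neg, inner_neg_left]

theorem inner_testToL2_polyLaplacian (m : ℕ) (φ χ : 𝓓(Ω, ℝ)) :
    inner ℝ (testToL2 Ω φ) (testToL2 Ω (polyLaplacian Ω m χ)) =
      ∑ w : Fin m → Fin N, inner ℝ (testToL2 Ω (∂^{fun a => coordVec (w a)} φ))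
        (testToL2 Ω (∂^{fun a => coordVec (w a)} χ)) := by
  simp only [inner_testToL2_eq_integral_fourier, toSchwartz_iteratedLineDerivOp]
  rw [← integral_finsetSum _ fun w _ => integrable_inner_schwartz _ _]
  simp only [sum_inner_fourier_iteratedLineDerivOp, fourier_toSchwartz_polyLaplacian,
    ← Complex.real_smul, inner_smul_right]

theorem eq_zero_of_inner_testToL2_eq_zero {f : L2 Ω}
    (h : ∀ χ : 𝓓(Ω, ℝ), inner ℝ (testToL2 Ω χ) f = 0) : f = 0 := by
  have hf : LocallyIntegrableOn f (Ω : Set (Space N)) volume :=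
    locallyIntegrableOn_of_locallyIntegrable_restrict
      ((Lp.memLp f).locallyIntegrable (by norm_num))
  refine (Lp.eq_zero_iff_ae_eq_zero).2 ((ae_restrict_iff' Ω.isOpen.measurableSet).2 ?_)
  refine IsOpen.ae_eq_zero_of_integral_contDiff_smul_eq_zero Ω.isOpen hf fun g hg hgc hgs => ?_
  rw [← h ⟨g, hg, hgc, hgs⟩, inner_testToL2_eq_setIntegral,
    ← setIntegral_eq_integral_of_forall_compl_eq_zero (s := (Ω : Set (Space N)))]
  · rfl
  · intro x hx
    rw [image_eq_zero_of_notMem_tsupport fun h => hx (hgs h), zero_smul]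

end TestFunctions

section Energy

variable {N : ℕ} {Ω : Opens (Space N)} {m : ℕ}

/-- A test function as an element of `H^m_0(Ω)`. -/
def testToHm0 (m : ℕ) (φ : 𝓓(Ω, ℝ)) : Hm0 Ω m :=
  ⟨jet Ω m φ, subset_closure ⟨φ, rfl⟩⟩

@[simp]
theorem toL2_testToHm0 (φ : 𝓓(Ω, ℝ)) : toL2 (testToHm0 m φ) = testToL2 Ω φ := rfl

theorem denseRange_testToHm0 : DenseRange (testToHm0 (Ω := Ω) m) := by
  intro u
  have himage : Subtype.val '' Set.range (testToHm0 (Ω := Ω) m) = LinearMap.range (jet Ω m) := by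
    ext x
    simp [testToHm0]
  rw [closure_subtype, himage]
  exact u.2

/-- The weak derivative of index `i` of an element of `H^m_0(Ω)`. -/
def jetComponent (i : JetIndex N m) : Hm0 Ω m →L[ℝ] L2 Ω :=
  (PiLp.proj 2 (fun _ : JetIndex N m => L2 Ω) i).comp (Hm0 Ω m).subtypeL

theorem toL2_injective : Function.Injective (toL2 : Hm0 Ω m → L2 Ω) := by
  refine (injective_iff_map_eq_zero _).2 fun u hu => ?_
  ext1
  ext1 i
  refine eq_zero_of_inner_testToL2_eq_zero fun χ => ?_
  obtain ⟨η, hη⟩ :=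
    exists_inner_testToL2_iteratedLineDerivOp (fun a => coordVec (i.2 a)) χ
  have hadjoint : inner ℝ (testToL2 Ω χ) (jetComponent i u) = inner ℝ (testToL2 Ω η) (toL2 u) :=
    denseRange_testToHm0.induction_on u (isClosed_eq (by fun_prop) (by fun_prop)) hη
  exact hadjoint.trans (by rw [hu, inner_zero_right])

/-- The form `∑_{|w| = m} ∫_Ω ∂^w u ∂^w v` on `H^m_0(Ω)`, the weak form of `(-Δ)^m`. -/
def energy (Ω : Opens (Space N)) (m : ℕ) : LinearMap.BilinForm ℝ (Hm0 Ω m) :=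
  ∑ w : Fin m → Fin N, (innerₗ (L2 Ω)).compl₁₂ (jetComponent ⟨Fin.last m, w⟩).toLinearMap
    (jetComponent ⟨Fin.last m, w⟩).toLinearMap

theorem energy_apply (u v : Hm0 Ω m) : energy Ω m u v =
    ∑ w : Fin m → Fin N, inner ℝ (jetComponent ⟨Fin.last m, w⟩ u)
      (jetComponent ⟨Fin.last m, w⟩ v) := by
  simp [energy]

theorem isSymm_energy (Ω : Opens (Space N)) (m : ℕ) : (energy Ω m).IsSymm :=
  ⟨fun u v => by
    simp only [energy_apply]
    exact Finset.sum_congr rfl fun _ _ => real_inner_comm _ _⟩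

theorem continuous_energy : Continuous fun p : Hm0 Ω m × Hm0 Ω m => energy Ω m p.1 p.2 := by
  simp only [energy_apply]
  fun_prop

theorem pairing_polyLaplacian (u : Hm0 Ω m) (φ : 𝓓(Ω, ℝ)) :
    pairing u (polyLaplacian Ω m φ) = energy Ω m u (testToHm0 m φ) := by
  rw [pairing_eq_inner]
  refine denseRange_testToHm0.induction_on u (isClosed_eq (by fun_prop)
    (continuous_energy.comp (by fun_prop : Continuous fun u => (u, testToHm0 m φ)))) fun χ => ?_
  rw [toL2_testToHm0, real_inner_comm, inner_testToL2_polyLaplacian, energy_apply]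
  rfl

theorem pairing_eq_inner_testToHm0 (u : Hm0 Ω m) (φ : 𝓓(Ω, ℝ)) :
    pairing u φ = inner ℝ (toL2 u) (toL2 (testToHm0 m φ)) := by
  rw [pairing_eq_inner, real_inner_comm, toL2_testToHm0]

theorem forall_testToHm0_eq_iff {u : Hm0 Ω m} {f : L2 Ω} :
    (∀ φ, energy Ω m u (testToHm0 m φ) = inner ℝ f (toL2 (testToHm0 m φ))) ↔
      ∀ v, energy Ω m u v = inner ℝ f (toL2 v) := by
  refine ⟨fun h v => denseRange_testToHm0.induction_on v (isClosed_eq ?_ (by fun_prop)) h,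
    fun h φ => h _⟩
  exact continuous_energy.comp (by fun_prop : Continuous fun v => (u, v))

theorem energy_testToHm0_self (φ : 𝓓(Ω, ℝ)) :
    energy Ω m (testToHm0 m φ) (testToHm0 m φ) =
      ∫ ξ, ((2 * Real.pi * ‖ξ‖) ^ 2) ^ m * ‖𝓕 (toSchwartz Ω φ) ξ‖ ^ 2 := by
  rw [← pairing_polyLaplacian, pairing_eq_inner_testToHm0, toL2_testToHm0, toL2_testToHm0,
    inner_testToL2_eq_integral_fourier]
  simp only [fourier_toSchwartz_polyLaplacian, ← Complex.real_smul, inner_smul_right,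
    real_inner_self_eq_norm_sq]

end Energy

section FourierL2

variable {V : Type*} [MeasurableSpace V] {μ : Measure V}

/-- The inclusion of real `L²(μ)` into complex `L²(μ)`. -/
def complexifyL2 (μ : Measure V) : Lp ℝ 2 μ →L[ℝ] Lp ℂ 2 μ :=
  Complex.ofRealCLM.compLpL 2 μ

theorem inner_complexifyL2 (f g : Lp ℝ 2 μ) :
    inner ℂ (complexifyL2 μ f) (complexifyL2 μ g) = (inner ℝ f g : ℝ) := by
  rw [L2.inner_def, L2.inner_def, ← integral_complex_ofReal]
  refine integral_congr_ae ?_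
  filter_upwards [Complex.ofRealCLM.coeFn_compLpL f, Complex.ofRealCLM.coeFn_compLpL g]
    with x hf hg
  simp [complexifyL2, hf, hg]

variable [NormedAddCommGroup V] [InnerProductSpace ℝ V]

/-- The Fourier transform `ξ ↦ ∫ exp (-2πi⟪x, ξ⟫) f(x) dμ(x)` of a real function `f ∈ L²(μ)`. For
`μ` the restriction of the Lebesgue measure to `Ω` this is the Fourier transform of the extension
of `f` by zero. -/
def fourierL2 (f : Lp ℝ 2 μ) : V → ℂ :=
  VectorFourier.fourierIntegral 𝐞 μ (innerₗ V) fun x => (f x : ℂ)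

variable [BorelSpace V] [IsFiniteMeasure μ]

theorem continuous_fourierL2 (f : Lp ℝ 2 μ) : Continuous (fourierL2 f) :=
  VectorFourier.fourierIntegral_continuous Real.continuous_fourierChar continuous_inner
    ((Lp.memLp f).integrable (by norm_num)).ofReal

variable [SecondCountableTopology V]

variable (μ) in
theorem memLp_planeWave (ξ : V) :
    MemLp (fun x => (Real.fourierChar (inner ℝ x ξ) : ℂ)) 2 μ :=
  MemLp.of_bound (by fun_prop) 1 (Eventually.of_forall fun _ => (Circle.norm_coe _).le)

variable (μ) in
/-- The plane wave `x ↦ exp (2πi⟪x, ξ⟫)` in `L²(μ)`. -/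
def planeWave (ξ : V) : Lp ℂ 2 μ :=
  (memLp_planeWave μ ξ).toLp

theorem norm_planeWave_sq (ξ : V) : ‖planeWave μ ξ‖ ^ 2 = μ.real Set.univ := by
  rw [← inner_self_eq_norm_sq (𝕜 := ℂ), L2.inner_def]
  have : (fun x => inner ℂ (planeWave μ ξ x) (planeWave μ ξ x)) =ᵐ[μ] fun _ => 1 := by
    filter_upwards [(memLp_planeWave μ ξ).coeFn_toLp] with x hx
    simp [planeWave, hx, Circle.norm_coe]
  rw [integral_congr_ae this]
  simp

theorem fourierL2_eq_inner (f : Lp ℝ 2 μ) (ξ : V) :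
    fourierL2 f ξ = inner ℂ (planeWave μ ξ) (complexifyL2 μ f) := by
  rw [L2.inner_def]
  refine integral_congr_ae ?_
  filter_upwards [(memLp_planeWave μ ξ).coeFn_toLp, Complex.ofRealCLM.coeFn_compLpL f]
    with x hξ hf
  simp [planeWave, complexifyL2, hξ, hf, Circle.smul_def, AddChar.map_neg_eq_inv,
    mul_comm]

theorem continuous_fourierL2_apply (ξ : V) : Continuous fun f : Lp ℝ 2 μ => fourierL2 f ξ := by
  simp only [fourierL2_eq_inner]
  fun_prop

theorem sum_norm_fourierL2_sq_le {ι : Type*} [Fintype ι] {e : ι → Lp ℝ 2 μ}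
    (he : Orthonormal ℝ e) (ξ : V) : ∑ i, ‖fourierL2 (e i) ξ‖ ^ 2 ≤ μ.real Set.univ := by
  have heℂ : Orthonormal ℂ fun i => complexifyL2 μ (e i) := by
    classical
    rw [orthonormal_iff_ite] at he ⊢
    simp [inner_complexifyL2, he, apply_ite]
  simpa only [fourierL2_eq_inner, norm_planeWave_sq, norm_inner_symm] using
    heℂ.sum_inner_products_le (x := planeWave μ ξ) (s := Finset.univ)

theorem norm_fourierL2_sq_le (f : Lp ℝ 2 μ) (ξ : V) :
    ‖fourierL2 f ξ‖ ^ 2 ≤ μ.real Set.univ * ‖f‖ ^ 2 := by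
  have hnorm : ‖complexifyL2 μ f‖ ^ 2 = ‖f‖ ^ 2 := by
    rw [← inner_self_eq_norm_sq (𝕜 := ℂ), inner_complexifyL2, real_inner_self_eq_norm_sq]
    exact Complex.ofReal_re _
  rw [fourierL2_eq_inner, ← norm_planeWave_sq ξ, ← hnorm, ← mul_pow]
  gcongr
  exact norm_inner_le_norm _ _

variable {ν : Measure V} [IsFiniteMeasure ν]

theorem integrable_norm_fourierL2_sq (f : Lp ℝ 2 μ) :
    Integrable (fun ξ => ‖fourierL2 f ξ‖ ^ 2) ν :=
  .of_bound ((continuous_fourierL2 f).norm.pow 2).aestronglyMeasurable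
    (μ.real Set.univ * ‖f‖ ^ 2) (Eventually.of_forall fun ξ => by
      simpa using norm_fourierL2_sq_le f ξ)

theorem continuous_integral_norm_fourierL2_sq :
    Continuous fun f : Lp ℝ 2 μ => ∫ ξ, ‖fourierL2 f ξ‖ ^ 2 ∂ν := by
  refine continuous_iff_continuousAt.2 fun f₀ => continuousAt_of_dominated
    (bound := fun _ => μ.real Set.univ * (‖f₀‖ + 1) ^ 2)
    (Eventually.of_forall fun f => (integrable_norm_fourierL2_sq f).aestronglyMeasurable) ?_
    (integrable_const _) (Eventually.of_forall fun ξ =>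
      ((continuous_fourierL2_apply ξ).norm.pow 2).continuousAt)
  filter_upwards [continuous_norm.continuousAt.eventually_lt_const (lt_add_one ‖f₀‖)] with f hf
  refine Eventually.of_forall fun ξ => ?_
  rw [norm_pow, norm_norm]
  exact (norm_fourierL2_sq_le f ξ).trans (by gcongr)

theorem sum_integral_norm_fourierL2_sq_le {ι : Type*} [Fintype ι] {e : ι → Lp ℝ 2 μ}
    (he : Orthonormal ℝ e) :
    ∑ i, ∫ ξ, ‖fourierL2 (e i) ξ‖ ^ 2 ∂ν ≤ ν.real Set.univ * μ.real Set.univ := by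
  rw [← integral_finsetSum _ fun i _ => integrable_norm_fourierL2_sq _, ← smul_eq_mul,
    ← integral_const]
  exact integral_mono (integrable_finsetSum _ fun i _ => integrable_norm_fourierL2_sq _)
    (integrable_const _) (sum_norm_fourierL2_sq_le he)

end FourierL2

section Counting

variable {N : ℕ} {Ω : Opens (Space N)} {m : ℕ}

theorem fourierL2_testToL2 (φ : 𝓓(Ω, ℝ)) : fourierL2 (testToL2 Ω φ) = 𝓕 (toSchwartz Ω φ) := by
  ext ξ
  rw [SchwartzMap.fourier_coe, Real.fourier_eq, ← setIntegral_eq_integral_of_forall_compl_eq_zero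
    (s := (Ω : Set (Space N))) fun x hx => ?_]
  · refine integral_congr_ae ?_
    filter_upwards [testToL2_coeFn φ] with x hx
    simp [hx]
  · have : φ x = 0 := Function.notMem_support.1 fun h => hx (support_test_subset φ h)
    simp [this]

theorem integral_le_setIntegral_add_inv_mul_integral_mul {α : Type*} [MeasurableSpace α]
    {ν : Measure α} {f w : α → ℝ} (hf : Integrable f ν) (hwf : Integrable (fun x => w x * f x) ν)
    (hf0 : 0 ≤ f) (hw0 : 0 ≤ w) {s : Set α} (hs : MeasurableSet s) {K : ℝ} (hK : 0 < K)
    (hKw : ∀ x ∉ s, K ≤ w x) :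
    ∫ x, f x ∂ν ≤ (∫ x in s, f x ∂ν) + K⁻¹ * ∫ x, w x * f x ∂ν := by
  rw [← integral_indicator hs, ← integral_const_mul,
    ← integral_add (hf.indicator hs) (hwf.const_mul _)]
  refine integral_mono hf ((hf.indicator hs).add (hwf.const_mul _)) fun x => ?_
  by_cases hx : x ∈ s
  · simp only [Set.indicator_of_mem hx]
    exact le_add_of_nonneg_right
      (mul_nonneg (inv_nonneg.2 hK.le) (mul_nonneg (hw0 x) (hf0 x)))
  · simp only [Set.indicator_of_notMem hx, zero_add, ← mul_assoc]
    refine le_mul_of_one_le_left (hf0 x) ?_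
    rw [inv_mul_eq_div, one_le_div hK]
    exact hKw x hx

theorem norm_testToL2_sq_le {R : ℝ} (hR : 0 < R) (φ : 𝓓(Ω, ℝ)) :
    ‖testToL2 Ω φ‖ ^ 2 ≤ (∫ ξ in Metric.closedBall 0 R, ‖fourierL2 (testToL2 Ω φ) ξ‖ ^ 2) +
      (((2 * Real.pi * R) ^ 2) ^ m)⁻¹ * energy Ω m (testToHm0 m φ) (testToHm0 m φ) := by
  have hint : Integrable fun ξ => ‖𝓕 (toSchwartz Ω φ) ξ‖ ^ 2 := by
    simpa only [real_inner_self_eq_norm_sq] using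
      integrable_inner_schwartz (𝓕 (toSchwartz Ω φ)) (𝓕 (toSchwartz Ω φ))
  have hint_weight :
      Integrable fun ξ => ((2 * Real.pi * ‖ξ‖) ^ 2) ^ m * ‖𝓕 (toSchwartz Ω φ) ξ‖ ^ 2 := by
    simpa only [fourier_toSchwartz_polyLaplacian, ← Complex.real_smul, inner_smul_right,
      real_inner_self_eq_norm_sq] using integrable_inner_schwartz (𝓕 (toSchwartz Ω φ))
        (𝓕 (toSchwartz Ω (polyLaplacian Ω m φ)))
  rw [← real_inner_self_eq_norm_sq, inner_testToL2_eq_integral_fourier, energy_testToHm0_self,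
    fourierL2_testToL2]
  simp only [real_inner_self_eq_norm_sq]
  refine integral_le_setIntegral_add_inv_mul_integral_mul hint hint_weight
    (fun _ => by positivity) (fun _ => by positivity) Metric.isClosed_closedBall.measurableSet
    (by positivity) fun ξ hξ => ?_
  rw [mem_closedBall_zero_iff, not_le] at hξ
  gcongr

theorem norm_toL2_sq_le (hΩ : volume (Ω : Set (Space N)) ≠ ⊤) {R : ℝ} (hR : 0 < R)
    (u : Hm0 Ω m) :
    ‖toL2 u‖ ^ 2 ≤ (∫ ξ in Metric.closedBall 0 R, ‖fourierL2 (toL2 u) ξ‖ ^ 2) +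
      (((2 * Real.pi * R) ^ 2) ^ m)⁻¹ * energy Ω m u u := by
  have : IsFiniteMeasure (volume.restrict (Ω : Set (Space N))) := ⟨by simpa using hΩ.lt_top⟩
  have : IsFiniteMeasure (volume.restrict (Metric.closedBall (0 : Space N) R)) :=
    ⟨by simpa using measure_closedBall_lt_top⟩
  refine denseRange_testToHm0.induction_on u (isClosed_le (by fun_prop) (.add ?_ (.const_mul ?_ _)))
    fun φ => norm_testToL2_sq_le hR φ
  · exact continuous_integral_norm_fourierL2_sq.comp toL2.continuous
  · exact continuous_energy.comp (by fun_prop : Continuous fun u : Hm0 Ω m => (u, u))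

theorem exists_half_le_setIntegral_norm_fourierL2_sq (hΩ : volume (Ω : Set (Space N)) ≠ ⊤)
    (hm : m ≠ 0) (Λ : ℝ) : ∃ R : ℝ, ∀ u : Hm0 Ω m, ‖toL2 u‖ = 1 → energy Ω m u u ≤ Λ →
      1 / 2 ≤ ∫ ξ in Metric.closedBall 0 R, ‖fourierL2 (toL2 u) ξ‖ ^ 2 := by
  set R : ℝ := 2 * (|Λ| + 1)
  have hR : 1 ≤ R := by linarith [abs_nonneg Λ]
  have hΛR : Λ ≤ R / 2 := by linarith [le_abs_self Λ]
  have hRK : R ≤ ((2 * Real.pi * R) ^ 2) ^ m := by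
    have hπ : 1 * R ≤ 2 * Real.pi * R := by gcongr; linarith [Real.pi_gt_three]
    have hsq : R ≤ (2 * Real.pi * R) ^ 2 := by nlinarith
    exact hsq.trans (le_self_pow₀ (hR.trans hsq) hm)
  refine ⟨R, fun u hu hΛ => ?_⟩
  have hnorm := norm_toL2_sq_le hΩ (one_pos.trans_le hR) u
  have hhigh : (((2 * Real.pi * R) ^ 2) ^ m)⁻¹ * energy Ω m u u ≤ 1 / 2 := by
    rw [inv_mul_le_iff₀ (by positivity)]
    linarith
  rw [hu] at hnorm
  linarith

theorem hasFiniteCounting_energy (hΩ : volume (Ω : Set (Space N)) ≠ ⊤) (hm : m ≠ 0) :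
    HasFiniteCounting (energy Ω m) toL2 := by
  intro Λ
  obtain ⟨R, hmass⟩ := exists_half_le_setIntegral_norm_fourierL2_sq hΩ hm Λ
  have : IsFiniteMeasure (volume.restrict (Ω : Set (Space N))) := ⟨by simpa using hΩ.lt_top⟩
  set ν := volume.restrict (Metric.closedBall (0 : Space N) R)
  have : IsFiniteMeasure ν := ⟨by simpa [ν] using measure_closedBall_lt_top⟩
  set C : ℝ := ν.real Set.univ * (volume.restrict (Ω : Set (Space N))).real Set.univ
  obtain ⟨M, hM⟩ := exists_nat_ge (2 * C)
  refine ⟨M, fun n u hu hΛ => ?_⟩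
  have hsum : (n : ℝ) / 2 ≤ C :=
    calc (n : ℝ) / 2 = ∑ _i : Fin n, (1 / 2 : ℝ) := by simp; ring
      _ ≤ ∑ i, ∫ ξ, ‖fourierL2 (toL2 (u i)) ξ‖ ^ 2 ∂ν :=
        Finset.sum_le_sum fun i _ => hmass (u i) (hu.1 i) (hΛ i)
      _ ≤ C := sum_integral_norm_fourierL2_sq_le hu
  exact_mod_cast (show (n : ℝ) ≤ M by linarith)

end Counting

section Equilibria

variable {N : ℕ} {Ω : Opens (Space N)} {m : ℕ} {lam : ℝ}

theorem integralMul_eq_inner (u v : Hm0 Ω m) : integralMul u v = inner ℝ (toL2 u) (toL2 v) := by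
  rw [integralMul, L2.inner_def]
  refine integral_congr_ae (Eventually.of_forall fun x => ?_)
  simp only [RCLike.inner_apply, conj_trivial]
  exact mul_comm _ _

theorem integralMul_self (u : Hm0 Ω m) : integralMul u u = ‖toL2 u‖ ^ 2 := by
  rw [integralMul_eq_inner, real_inner_self_eq_norm_sq]

theorem hasFDerivAt_opV' (lam : ℝ) (ψ : Hm0 Ω m) (φ : 𝓓(Ω, ℝ)) :
    ∃ D : Hm0 Ω m →L[ℝ] ℝ, HasFDerivAt (fun u : Hm0 Ω m => opV' lam u φ) D ψ ∧
      ∀ v, D v = -pairing v (polyLaplacian Ω m φ) + lam * pairing v φ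
        - 2 * pairing ψ φ * integralMul ψ v - pairing v φ * integralMul ψ ψ := by
  let P : 𝓓(Ω, ℝ) → Hm0 Ω m →L[ℝ] ℝ := fun χ => innerSL ℝ (testToL2 Ω χ) ∘L toL2
  have hP : ∀ χ (u : Hm0 Ω m), pairing u χ = P χ u := fun χ u => pairing_eq_inner u χ
  have hT : HasFDerivAt (fun u : Hm0 Ω m => toL2 u) toL2 ψ := toL2.hasFDerivAt
  have hV' := (((P (polyLaplacian Ω m φ)).hasFDerivAt (x := ψ)).neg.add
    (((P φ).hasFDerivAt (x := ψ)).const_mul lam)).sub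
      ((hT.inner ℝ hT).mul ((P φ).hasFDerivAt (x := ψ)))
  refine ⟨_, hV'.congr_of_eventuallyEq (Eventually.of_forall fun u => ?_), fun v => ?_⟩
  · simp [opV', hP, integralMul_eq_inner]
  · simp only [hP, integralMul_eq_inner, add_apply, sub_apply, neg_apply, smul_apply,
      smul_eq_mul, ContinuousLinearMap.comp_apply, ContinuousLinearMap.prod_apply,
      fderivInnerCLM_apply, real_inner_comm (toL2 ψ) (toL2 v)]
    ring

theorem opV''_apply (lam : ℝ) (ψ v : Hm0 Ω m) (φ : 𝓓(Ω, ℝ)) :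
    opV'' lam ψ v φ = -pairing v (polyLaplacian Ω m φ) + lam * pairing v φ
        - 2 * pairing ψ φ * integralMul ψ v - pairing v φ * integralMul ψ ψ := by
  obtain ⟨D, hD, hDv⟩ := hasFDerivAt_opV' lam ψ φ
  rw [opV'', hD.fderiv, hDv]

theorem eigenspace_eq_weakEigenspace (μ : ℝ) :
    eigenspace Ω m μ = weakEigenspace (energy Ω m) toL2 μ := by
  ext u
  simp only [mem_weakEigenspace, ← real_inner_smul_left, ← forall_testToHm0_eq_iff]
  refine forall_congr' fun φ => ?_
  rw [pairing_polyLaplacian, pairing_eq_inner_testToHm0, real_inner_smul_left]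

theorem equilibria_eq_weakEquilibria :
    equilibria Ω m lam = weakEquilibria (energy Ω m) toL2 lam := by
  ext ψ
  rw [mem_weakEquilibria, ← eigenspace_eq_weakEigenspace]
  refine forall_congr' fun φ => ?_
  rw [opV', integralMul_self]
  constructor <;> intro h <;> linarith

theorem kerV''_eq_weakKernel (ψ : Hm0 Ω m) :
    kerV'' lam ψ = weakKernel (energy Ω m) toL2 lam ψ := by
  ext v
  have htest := forall_testToHm0_eq_iff (u := v) (f := (lam - ‖toL2 ψ‖ ^ 2) • toL2 v
    - (2 * inner ℝ (toL2 ψ) (toL2 v)) • toL2 ψ)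
  simp only [inner_sub_left, real_inner_smul_left] at htest
  rw [mem_weakKernel, ← htest]
  refine forall_congr' fun φ => ?_
  rw [opV''_apply, pairing_polyLaplacian, integralMul_self, integralMul_eq_inner,
    pairing_eq_inner_testToHm0, pairing_eq_inner_testToHm0]
  constructor <;> intro h <;> linarith

theorem finiteDimensional_kerV'' (hΩ : volume (Ω : Set (Space N)) ≠ ⊤) (hm : m ≠ 0)
    {ψ : Hm0 Ω m} (hψ : ψ ∈ equilibria Ω m lam) : FiniteDimensional ℝ (kerV'' lam ψ) := by
  rw [equilibria_eq_weakEquilibria] at hψ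
  rw [kerV''_eq_weakKernel]
  have := (hasFiniteCounting_energy (m := m) hΩ hm).finiteDimensional_weakEigenspace
    toL2_injective (lam - ‖toL2 ψ‖ ^ 2)
  exact Submodule.finiteDimensional_of_le (weakKernel_le_weakEigenspace (isSymm_energy Ω m) hψ)

theorem resonanceHypothesis (hΩ : volume (Ω : Set (Space N)) ≠ ⊤) (hm : m ≠ 0) (lam : ℝ) :
    ResonanceHypothesis Ω m lam := by
  rintro ψ ⟨hψ, hacc⟩ k - rfl
  rw [kerV''_eq_weakKernel]
  rw [equilibria_eq_weakEquilibria] at hψ hacc ⊢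
  have hcount := hasFiniteCounting_energy (m := m) hΩ hm
  have := hcount.finiteDimensional_weakEigenspace toL2_injective (lam - ‖toL2 ψ‖ ^ 2)
  refine exists_isSmoothSubmanifold_weakEquilibria_inter (isSymm_energy Ω m) toL2_injective hψ ?_
  rintro rfl
  exact hcount.not_accPt_zero_weakEquilibria (isSymm_energy Ω m) toL2_injective lam hacc

end Equilibria

end NonlocalResonance

end

open NonlocalResonance in
theorem mainTheorem5_general {N : ℕ} {Ω : Opens (Space N)} (hΩ : volume (Ω : Set (Space N)) ≠ ⊤)
    {m : ℕ} (hm : m ≠ 0) (lamL : ℝ) :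
    ResonanceHypothesis Ω m lamL ∧
    (∀ ψ ∈ equilibria Ω m lamL, FiniteDimensional ℝ (kerV'' lamL ψ)) ∧
    (∀ (ψ : Hm0 Ω m) (φ : 𝓓(Ω, ℝ)),
      DifferentiableAt ℝ (fun u : Hm0 Ω m => opV' lamL u φ) ψ ∧
      ∀ v : Hm0 Ω m, opV'' lamL ψ v φ = -pairing v (polyLaplacian Ω m φ) + lamL * pairing v φ
        - 2 * pairing ψ φ * integralMul ψ v - pairing v φ * integralMul ψ ψ) ∧
    ∀ (lamJ : ℝ) (k : ℕ) (e : Fin (k + 1) → Hm0 Ω m), lamJ < lamL → 1 ≤ k →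
      Module.finrank ℝ (eigenspace Ω m lamJ) = k + 1 → (∀ i, e i ∈ eigenspace Ω m lamJ) →
      Orthonormal ℝ (fun i => toL2 (e i)) →
      ∀ S : Set (Hm0 Ω m),
      S = {ψ | ∃ c : Fin (k + 1) → ℝ, ∑ i, c i ^ 2 = lamL - lamJ ∧ ψ = ∑ i, c i • e i} →
        (∀ c : Fin (k + 1) → ℝ, ∑ i, c i • e i ∈ equilibria Ω m lamL ↔
          c = 0 ∨ ∑ i, c i ^ 2 = lamL - lamJ) ∧
        IsSmoothSubmanifold k S ∧
        ∀ c : Fin (k + 1) → ℝ, ∑ i, c i ^ 2 = lamL - lamJ →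
          BranchingAt lamL (∑ i, c i • e i) ∧
          (∃ ε > 0, ∀ ψ : Hm0 Ω m, ‖toL2 ψ - toL2 (∑ i, c i • e i)‖ < ε →
            (ψ ∈ equilibria Ω m lamL ↔ ψ ∈ S)) ∧
          connectedComponentIn (equilibria Ω m lamL) (∑ i, c i • e i) = S ∧
          (∀ v : Hm0 Ω m, v ∈ kerV'' lamL (∑ i, c i • e i) ↔
            ∃ b : Fin (k + 1) → ℝ, ∑ i, b i * c i = 0 ∧ v = ∑ i, b i • e i) ∧
          Module.finrank ℝ (kerV'' lamL (∑ i, c i • e i)) = k := by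
  refine ⟨resonanceHypothesis hΩ hm lamL, fun ψ => finiteDimensional_kerV'' hΩ hm, fun ψ φ =>
    ⟨(hasFDerivAt_opV' lamL ψ φ).choose_spec.1.differentiableAt, fun v => opV''_apply lamL ψ v φ⟩,
    ?_⟩
  intro lamJ k e hlam hk hdim he horth S hS
  rw [eigenspace_eq_weakEigenspace] at hdim
  simp only [BranchingAt, eigenspace_eq_weakEigenspace, equilibria_eq_weakEquilibria,
    kerV''_eq_weakKernel] at he ⊢
  have hsymm := isSymm_energy Ω m
  have hdim1 : 1 < Module.finrank ℝ (weakEigenspace (energy Ω m) toL2 lamJ) :=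
    hdim ▸ Nat.lt_succ_of_le hk
  have hcard := hdim.trans (Fintype.card_fin _).symm
  rw [← levelSphere_eq_sum_smul horth he hcard] at hS
  refine ⟨sum_smul_mem_weakEquilibria_iff toL2_injective horth he,
    hS ▸ isSmoothSubmanifold_levelSphere toL2_injective hdim (sub_pos.2 hlam), fun c hc => ?_⟩
  have hmem : ∑ i, c i • e i ∈ levelSphere toL2 (weakEigenspace (energy Ω m) toL2 lamJ)
      (lamL - lamJ) := (levelSphere_eq_sum_smul horth he hcard _).ge ⟨c, hc, rfl⟩
  have hacc := accPt_levelSphere toL2_injective hdim1 (sub_pos.2 hlam) hmem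
  refine ⟨⟨levelSphere_subset_weakEquilibria hmem,
      hacc.mono (principal_mono.2 levelSphere_subset_weakEquilibria)⟩,
    ⟨_, norm_pos_iff.2 (map_ne_zero_of_mem_levelSphere (sub_pos.2 hlam).ne' hmem),
      fun ψ hψ => hS ▸ mem_weakEquilibria_iff_mem_levelSphere hsymm hmem hψ⟩,
    hS ▸ connectedComponentIn_weakEquilibria hsymm toL2_injective hdim1 hlam hmem,
    fun v => mem_weakKernel_sum_smul_iff hsymm horth he hcard hc,
    kerV''_eq_weakKernel (∑ i, c i • e i) ▸
      finrank_weakKernel_of_mem_levelSphere hsymm hdim hlam.ne hmem⟩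

theorem mainTheorem5 {N : ℕ} (Ω : TopologicalSpace.Opens (NonlocalResonance.Space N))
    (hΩ : Bornology.IsBounded (Ω : Set (NonlocalResonance.Space N)))
    (m : ℕ) (hm : 1 ≤ m)
    (lamL : ℝ) (hL : NonlocalResonance.IsDirichletEigenvalue Ω m lamL) :
    -- the resonance branching hypothesis; all kernels are finite-dimensional
    NonlocalResonance.ResonanceHypothesis Ω m lamL ∧
    (∀ ψ ∈ NonlocalResonance.equilibria Ω m lamL,
      FiniteDimensional ℝ (NonlocalResonance.kerV'' lamL ψ)) ∧
    -- the formula for the linearization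
    (∀ (ψ : NonlocalResonance.Hm0 Ω m) (φ : 𝓓(Ω, ℝ)),
      DifferentiableAt ℝ
        (fun u : NonlocalResonance.Hm0 Ω m => NonlocalResonance.opV' lamL u φ) ψ ∧
      ∀ v : NonlocalResonance.Hm0 Ω m,
        NonlocalResonance.opV'' lamL ψ v φ =
          -NonlocalResonance.pairing v (NonlocalResonance.polyLaplacian Ω m φ)
            + lamL * NonlocalResonance.pairing v φ
            - 2 * NonlocalResonance.pairing ψ φ * NonlocalResonance.integralMul ψ v
            - NonlocalResonance.pairing v φ * NonlocalResonance.integralMul ψ ψ) ∧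
    -- equilibria built from an eigenspace of dimension `k + 1 ≥ 2`
    ∀ (lamJ : ℝ) (k : ℕ) (e : Fin (k + 1) → NonlocalResonance.Hm0 Ω m),
      lamJ < lamL → 1 ≤ k →
      Module.finrank ℝ (NonlocalResonance.eigenspace Ω m lamJ) = k + 1 →
      (∀ i, e i ∈ NonlocalResonance.eigenspace Ω m lamJ) →
      Orthonormal ℝ (fun i => NonlocalResonance.toL2 (e i)) →
      ∀ S : Set (NonlocalResonance.Hm0 Ω m),
      S = {ψ | ∃ c : Fin (k + 1) → ℝ, ∑ i, c i ^ 2 = lamL - lamJ ∧ ψ = ∑ i, c i • e i} →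
        (∀ c : Fin (k + 1) → ℝ, ∑ i, c i • e i ∈ NonlocalResonance.equilibria Ω m lamL ↔
          c = 0 ∨ ∑ i, c i ^ 2 = lamL - lamJ) ∧
        NonlocalResonance.IsSmoothSubmanifold k S ∧
        ∀ c : Fin (k + 1) → ℝ, ∑ i, c i ^ 2 = lamL - lamJ →
          NonlocalResonance.BranchingAt lamL (∑ i, c i • e i) ∧
          -- near the given equilibrium (in `L²`), the equilibria are exactly the points of `S`
          (∃ ε > 0, ∀ ψ : NonlocalResonance.Hm0 Ω m,
            ‖NonlocalResonance.toL2 ψ - NonlocalResonance.toL2 (∑ i, c i • e i)‖ < ε →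
              (ψ ∈ NonlocalResonance.equilibria Ω m lamL ↔ ψ ∈ S)) ∧
          connectedComponentIn (NonlocalResonance.equilibria Ω m lamL) (∑ i, c i • e i) = S ∧
          -- the kernel of the linearization
          (∀ v : NonlocalResonance.Hm0 Ω m,
            v ∈ NonlocalResonance.kerV'' lamL (∑ i, c i • e i) ↔
              ∃ b : Fin (k + 1) → ℝ, ∑ i, b i * c i = 0 ∧ v = ∑ i, b i • e i) ∧
          Module.finrank ℝ (NonlocalResonance.kerV'' lamL (∑ i, c i • e i)) = k := by
  exact mainTheorem5_general hΩ.measure_lt_top.ne (Nat.one_le_iff_ne_zero.1 hm) lamL
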